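/- Let $R$ and $S$ be associative unital rings, $n\ge 1$ and $k\ge 0$ integers; modules are left modules, and right $R$-modules are modules over $R^{op}$. Definitions. A module $M$ over a ring $A$ is *finitely $n$-presented* if there is an exact sequence $F_n\to\cdots\to F_1\to F_0\to M\to 0$ with all $F_i$ finitely generated and free; $A$ is *$n$-coherent* if every finitely $n$-presented (left) $A$-module is finitely $(n+1)$-presented. An $(S,R)$-bimodule $C={}_SC_R$ is *semidualizing* if ${}_SC$ and $C_R$ have projective resolutions by finitely generated projective modules, the homothety maps $S\to\operatorname{Hom}_{R^{op}}(C,C)$ and $R\to\operatorname{Hom}_S(C,C)$ are bijective, and $\operatorname{Ext}^i_S(C,C)=0=\operatorname{Ext}^i_{R^{op}}(C,C)$ for all $i\ge 1$. It is *faithfully semidualizing* if moreover, for all modules ${}_SN$ and $M_R$, $\operatorname{Hom}_S(C,N)=0$ implies $N=0$ and $\operatorname{Hom}_{R^{op}}(C,M)=0$ implies $M=0$. The *Bass class* $\mathcal B_C(S)$ consists of the $S$-modules $N$ with $\operatorname{Ext}_S^i(C,N)=0$ and $\operatorname{Tor}^R_i(C,\operatorname{Hom}_S(C,N))=0$ for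 all $i\ge 1$ for which the evaluation map $C\otimes_R\operatorname{Hom}_S(C,N)\to N$ is an isomorphism. An $R$-module $Y$ is *$fp_n$-flat* if $K\otimes_RY\to L\otimes_RY$ is injective for every injective homomorphism $K\to L$ of finitely $n$-presented right $R$-modules. An $S$-module is *$C$-$fp_n$-flat* if it is isomorphic to $C\otimes_RY$ for some $fp_n$-flat $R$-module $Y$. The *$C$-$fp_n$-flat dimension* $\operatorname{Cfp}_n.\operatorname{fd}_S(N)$ of an $S$-module $N$ is the least $j\geq 0$ for which there is an exact sequence $0\to F_j\to\cdots\to F_0\to N\to 0$ of $S$-modules with all $F_i$ $C$-$fp_n$-flat ($\infty$ if there is none). Theorem. Assume that $R^{op}$ is $n$-coherent (that is, every finitely $n$-presented right $R$-module is finitely $(n+1)$-presented), that $C={}_SC_R$ is faithfully semidualizing, and that $N\in\mathcal B_C(S)$. Then the following are equivalent: (i) $\operatorname{Cfp}_n.\operatorname{fd}_S(N)\le k$; (ii) for every exact sequence $0\to N_k\to N_{k-1}\to\cdots\to N_1\to N_0\to N\to 0$ of $S$-modules in which $N_0,\dots,N_{k-1}$ are $C$-$fp_n$-flat, the module $N_k$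 is $C$-$fp_n$-flat; (iii) there is an exact sequence $0\to N_k\to N_{k-1}\to\cdots\to N_1\to N_0\to N\to 0$ of $S$-modules in which all of $N_0,\dots,N_k$ are $C$-$fp_n$-flat. -/

import Mathlib

open CategoryTheory MulOpposite
open scoped TensorProduct

universe u

noncomputable section

namespace Foxby

/-! ### Tensor products over a noncommutative ring

A right `R`-module is a `Module Rᵐᵒᵖ X`; thus `x r` is `op r • x`. -/

section Tensor

variable (R : Type u) [Ring R]
variable (X : Type u) [AddCommGroup X] [Module Rᵐᵒᵖ X]
variable (Y : Type u) [AddCommGroup Y] [Module R Y]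

/-- The subgroup of `X ⊗[ℤ] Y` generated by the elements `x r ⊗ y - x ⊗ r y`. -/
def balancedRel : Submodule ℤ (X ⊗[ℤ] Y) :=
  Submodule.span ℤ
    {t | ∃ (x : X) (r : R) (y : Y), t = (op r • x) ⊗ₜ[ℤ] y - x ⊗ₜ[ℤ] (r • y)}

/-- The tensor product `X ⊗_R Y` of a right `R`-module `X` and a left `R`-module `Y`. -/
def Tens : Type u := (X ⊗[ℤ] Y) ⧸ balancedRel R X Y

instance : AddCommGroup (Tens R X Y) :=
  inferInstanceAs (AddCommGroup ((X ⊗[ℤ] Y) ⧸ balancedRel R X Y))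

variable {X Y}

/-- The pure tensor `x ⊗ y` in `X ⊗_R Y`. -/
def Tens.tmul (x : X) (y : Y) : Tens R X Y := Submodule.Quotient.mk (x ⊗ₜ[ℤ] y)

theorem Tens.tmul_balanced (x : X) (r : R) (y : Y) :
    Tens.tmul R (op r • x) y = Tens.tmul R x (r • y) :=
  (Submodule.Quotient.eq _).2 (Submodule.subset_span ⟨x, r, y, rfl⟩)

variable {R}

/-- The map `X ⊗_R Y → A` induced by a biadditive `R`-balanced map `X × Y → A`. -/
def Tens.lift {A : Type u} [AddCommGroup A] (b : X →ₗ[ℤ] Y →ₗ[ℤ] A)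
    (hb : ∀ (x : X) (r : R) (y : Y), b (op r • x) y = b x (r • y)) : Tens R X Y →+ A :=
  ((balancedRel R X Y).liftQ (TensorProduct.lift b) (by
    refine Submodule.span_le.2 ?_
    rintro _ ⟨x, r, y, rfl⟩
    change TensorProduct.lift b _ = 0
    simp [hb])).toAddMonoidHom

@[simp] theorem Tens.lift_tmul {A : Type u} [AddCommGroup A] (b : X →ₗ[ℤ] Y →ₗ[ℤ] A)
    (hb : ∀ (x : X) (r : R) (y : Y), b (op r • x) y = b x (r • y)) (x : X) (y : Y) :
    Tens.lift b hb (Tens.tmul R x y) = b x y := rfl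

theorem Tens.hom_ext {A : Type u} [AddCommGroup A] {f g : Tens R X Y →+ A}
    (h : ∀ x y, f (Tens.tmul R x y) = g (Tens.tmul R x y)) : f = g := by
  have hh : ∀ t : X ⊗[ℤ] Y, f (Submodule.Quotient.mk t) = g (Submodule.Quotient.mk t) := by
    intro t
    induction t using TensorProduct.induction_on with
    | zero => exact (map_zero f).trans (map_zero g).symm
    | tmul x y => exact h x y
    | add a b ha hb =>
      exact (map_add f (Submodule.Quotient.mk a) (Submodule.Quotient.mk b)).trans
        ((congrArg₂ (· + ·) ha hb).trans
          (map_add g (Submodule.Quotient.mk a) (Submodule.Quotient.mk b)).symm)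
  ext t
  induction t using Submodule.Quotient.induction_on with
  | H t => exact hh t

theorem Tens.add_tmul (x x' : X) (y : Y) :
    Tens.tmul R (x + x') y = Tens.tmul R x y + Tens.tmul R x' y :=
  congrArg Submodule.Quotient.mk (TensorProduct.add_tmul x x' y)

theorem Tens.tmul_add (x : X) (y y' : Y) :
    Tens.tmul R x (y + y') = Tens.tmul R x y + Tens.tmul R x y' :=
  congrArg Submodule.Quotient.mk (TensorProduct.tmul_add x y y')

variable {X' : Type u} [AddCommGroup X'] [Module Rᵐᵒᵖ X']
variable {X'' : Type u} [AddCommGroup X''] [Module Rᵐᵒᵖ X'']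

variable (Y) in
/-- The map `f ⊗ Y : X ⊗_R Y → X' ⊗_R Y`, `x ⊗ y ↦ f x ⊗ y`, for right `R`-linear `f`. -/
def Tens.map (f : X →ₗ[Rᵐᵒᵖ] X') : Tens R X Y →+ Tens R X' Y :=
  Tens.lift (AddMonoidHom.toIntLinearMap
    { toFun := fun x => AddMonoidHom.toIntLinearMap
        { toFun := fun y => Tens.tmul R (f x) y
          map_zero' := by simpa using Tens.tmul_add (R := R) (f x) (0 : Y) 0
          map_add' := Tens.tmul_add (f x) }
      map_zero' := by
        ext y
        simpa using Tens.add_tmul (R := R) (0 : X') 0 y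
      map_add' := fun x x' => by
        ext y
        simp [Tens.add_tmul] })
    (fun x r y => by simp [Tens.tmul_balanced])

@[simp] theorem Tens.map_tmul (f : X →ₗ[Rᵐᵒᵖ] X') (x : X) (y : Y) :
    Tens.map Y f (Tens.tmul R x y) = Tens.tmul R (f x) y := rfl

theorem Tens.map_id : Tens.map Y (LinearMap.id : X →ₗ[Rᵐᵒᵖ] X) = AddMonoidHom.id _ :=
  Tens.hom_ext fun _ _ => rfl

theorem Tens.map_comp (g : X' →ₗ[Rᵐᵒᵖ] X'') (f : X →ₗ[Rᵐᵒᵖ] X') :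
    Tens.map Y (g ∘ₗ f) = (Tens.map Y g).comp (Tens.map Y f) :=
  Tens.hom_ext fun _ _ => rfl

theorem Tens.map_add (f g : X →ₗ[Rᵐᵒᵖ] X') :
    Tens.map Y (f + g) = Tens.map Y f + Tens.map Y g :=
  Tens.hom_ext fun x y => Tens.add_tmul (f x) (g x) y

/-- If `X` is an `(S, R)`-bimodule, then `X ⊗_R Y` is a left `S`-module,
with `s (x ⊗ y) = (s x) ⊗ y`. -/
instance Tens.module {S : Type u} [Ring S] [Module S X] [SMulCommClass S Rᵐᵒᵖ X] :
    Module S (Tens R X Y) where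
  smul s t := Tens.map Y (Module.toModuleEnd Rᵐᵒᵖ X s) t
  one_smul t := by
    change Tens.map Y (Module.toModuleEnd Rᵐᵒᵖ X (1 : S)) t = t
    rw [_root_.map_one]
    exact DFunLike.congr_fun Tens.map_id t
  mul_smul a b t := by
    change Tens.map Y (Module.toModuleEnd Rᵐᵒᵖ X (a * b)) t = _
    rw [_root_.map_mul]
    exact DFunLike.congr_fun (Tens.map_comp _ _) t
  smul_zero s := _root_.map_zero _
  smul_add s := _root_.map_add _
  add_smul a b t := by
    change Tens.map Y (Module.toModuleEnd Rᵐᵒᵖ X (a + b)) t = _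
    rw [_root_.map_add]
    exact DFunLike.congr_fun (Tens.map_add _ _) t
  zero_smul t := by
    change Tens.map Y (Module.toModuleEnd Rᵐᵒᵖ X (0 : S)) t = 0
    have h := Tens.map_add (Y := Y) (Module.toModuleEnd Rᵐᵒᵖ X (0 : S))
      (Module.toModuleEnd Rᵐᵒᵖ X (0 : S))
    rw [← _root_.map_add, add_zero] at h
    simpa using DFunLike.congr_fun h t

theorem Tens.smul_tmul {S : Type u} [Ring S] [Module S X] [SMulCommClass S Rᵐᵒᵖ X]
    (s : S) (x : X) (y : Y) : s • Tens.tmul R x y = Tens.tmul R (s • x) y := rfl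

end Tensor

/-- The additive functor `- ⊗_R Y` from right `R`-modules to abelian groups. -/
def tensFunctor (R : Type u) [Ring R] (Y : Type u) [AddCommGroup Y] [Module R Y] :
    ModuleCat.{u} Rᵐᵒᵖ ⥤ ModuleCat.{u} ℤ where
  obj X := ModuleCat.of ℤ (Tens R X Y)
  map f := ModuleCat.ofHom (Tens.map Y f.hom).toIntLinearMap
  map_id X := by
    ext t
    exact DFunLike.congr_fun Tens.map_id t
  map_comp f g := by
    ext t
    exact DFunLike.congr_fun (Tens.map_comp g.hom f.hom) t

instance (R : Type u) [Ring R] (Y : Type u) [AddCommGroup Y] [Module R Y] :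
    (tensFunctor R Y).Additive where
  map_add {_ _ f g} := by
    ext t
    exact DFunLike.congr_fun (Tens.map_add f.hom g.hom) t

/-- The group `Tor_i^R(X, Y)`: the value at `X` of the `i`-th left derived functor of `- ⊗_R Y`. -/
def tor (R : Type u) [Ring R] (X : Type u) [AddCommGroup X] [Module Rᵐᵒᵖ X]
    (Y : Type u) [AddCommGroup Y] [Module R Y] (i : ℕ) : ModuleCat.{u} ℤ :=
  ((tensFunctor R Y).leftDerived i).obj (ModuleCat.of Rᵐᵒᵖ X)

/-! ### Finiteness conditions -/

/-- `M` is finitely `n`-presented: there is an exact sequence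
`F_n → ⋯ → F_1 → F_0 → M → 0` with `F_i = A ^ (r i)`. (The maps `d i : F_{i+1} → F_i` with
`n ≤ i` are irrelevant.) -/
def FinPresented (n : ℕ) (A : Type u) [Ring A] (M : Type u) [AddCommGroup M] [Module A M] : Prop :=
  ∃ (r : ℕ → ℕ) (d : ∀ i, (Fin (r (i + 1)) → A) →ₗ[A] (Fin (r i) → A))
    (p : (Fin (r 0) → A) →ₗ[A] M),
    Function.Surjective p ∧ (0 < n → Function.Exact (d 0) p) ∧
      ∀ i, i + 1 < n → Function.Exact (d (i + 1)) (d i)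

/-- Every finitely `n`-presented left `A`-module is finitely `(n + 1)`-presented. -/
def IsNCoherent (n : ℕ) (A : Type u) [Ring A] : Prop :=
  ∀ M : ModuleCat.{u} A, FinPresented n A M → FinPresented (n + 1) A M

/-- `M` has a resolution `⋯ → P_1 → P_0 → M → 0` by finitely generated projective modules. -/
def HasDegreewiseFiniteProjRes (A : Type u) [Ring A] (M : Type u) [AddCommGroup M] [Module A M] :
    Prop :=
  ∃ (P : ℕ → ModuleCat.{u} A) (d : ∀ i, P (i + 1) →ₗ[A] P i) (p : P 0 →ₗ[A] M),
    (∀ i, Module.Finite A (P i) ∧ Module.Projective A (P i)) ∧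
      Function.Surjective p ∧ Function.Exact (d 0) p ∧
        ∀ i, Function.Exact (d (i + 1)) (d i)

/-- `Ext_A^i(M, N) = 0` for all `i ≥ 1`. -/
def ExtVanish (A : Type u) [Ring A] (M N : Type u) [AddCommGroup M] [Module A M]
    [AddCommGroup N] [Module A N] : Prop :=
  ∀ i : ℕ, 1 ≤ i → Subsingleton (Abelian.Ext (ModuleCat.of A M) (ModuleCat.of A N) i)

/-- `Tor_i^R(X, Y) = 0` for all `i ≥ 1`. -/
def TorVanish (R : Type u) [Ring R] (X : Type u) [AddCommGroup X] [Module Rᵐᵒᵖ X]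
    (Y : Type u) [AddCommGroup Y] [Module R Y] : Prop :=
  ∀ i : ℕ, 1 ≤ i → Subsingleton (tor R X Y i)

/-! ### Semidualizing bimodules and the Bass class -/

section Bimodule

variable (R S : Type u) [Ring R] [Ring S]
variable (C : Type u) [AddCommGroup C] [Module S C] [Module Rᵐᵒᵖ C] [SMulCommClass S Rᵐᵒᵖ C]

/-- Left multiplication by `s` on `C` as a right `R`-linear map. -/
def leftHomothety (s : S) : C →ₗ[Rᵐᵒᵖ] C where
  toFun c := s • c
  map_add' := smul_add s
  map_smul' a c := smul_comm s a c

/-- Right multiplication by `r` on `C` as a left `S`-linear map. -/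
def rightHomothety (r : R) : C →ₗ[S] C where
  toFun c := op r • c
  map_add' := smul_add (op r)
  map_smul' s c := (smul_comm s (op r) c).symm

/-- The `(S, R)`-bimodule `C` is semidualizing. -/
structure IsSemidualizing : Prop where
  finite_left : HasDegreewiseFiniteProjRes S C
  finite_right : HasDegreewiseFiniteProjRes Rᵐᵒᵖ C
  homothety_left : Function.Bijective (leftHomothety R S C)
  homothety_right : Function.Bijective (rightHomothety R S C)
  ext_left : ExtVanish S C C
  ext_right : ExtVanish Rᵐᵒᵖ C C

/-- The `(S, R)`-bimodule `C` is faithfully semidualizing. -/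
structure IsFaithfullySemidualizing : Prop extends IsSemidualizing R S C where
  faithful_left : ∀ N : ModuleCat.{u} S, Subsingleton (C →ₗ[S] N) → Subsingleton N
  faithful_right : ∀ M : ModuleCat.{u} Rᵐᵒᵖ, Subsingleton (C →ₗ[Rᵐᵒᵖ] M) → Subsingleton M

variable (N : Type u) [AddCommGroup N] [Module S N]

/-- `Hom_S(C, N)`, considered as a left `R`-module through `(r f)(c) = f(c r)`. -/
def BHom (R S C N : Type u) [Ring R] [Ring S] [AddCommGroup C] [Module S C] [Module Rᵐᵒᵖ C]
    [SMulCommClass S Rᵐᵒᵖ C] [AddCommGroup N] [Module S N] : Type u := C →ₗ[S] N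

instance : AddCommGroup (BHom R S C N) := inferInstanceAs (AddCommGroup (C →ₗ[S] N))

instance : Module R (BHom R S C N) where
  smul r f := LinearMap.comp (show C →ₗ[S] N from f) (rightHomothety R S C r)
  one_smul f := LinearMap.ext fun c =>
    congrArg (show C →ₗ[S] N from f) (one_smul Rᵐᵒᵖ c)
  mul_smul a b f := LinearMap.ext fun c =>
    congrArg (show C →ₗ[S] N from f) (mul_smul (op b) (op a) c)
  smul_zero _ := LinearMap.zero_comp _
  smul_add _ _ _ := LinearMap.add_comp _ _ _
  add_smul a b f := LinearMap.ext fun c =>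
    (congrArg (show C →ₗ[S] N from f) (add_smul (op a) (op b) c)).trans
      (map_add (show C →ₗ[S] N from f) (op a • c) (op b • c))
  zero_smul f := LinearMap.ext fun c =>
    (congrArg (show C →ₗ[S] N from f) (zero_smul Rᵐᵒᵖ c)).trans
      (map_zero (show C →ₗ[S] N from f))

/-- The natural evaluation map `ν_N : C ⊗_R Hom_S(C, N) → N`, `c ⊗ f ↦ f c`. -/
def evalMap : Tens R C (BHom R S C N) →+ N :=
  Tens.lift (AddMonoidHom.toIntLinearMap
    { toFun := fun c => AddMonoidHom.toIntLinearMap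
        { toFun := fun f : BHom R S C N => (show C →ₗ[S] N from f) c
          map_zero' := rfl
          map_add' := fun _ _ => rfl }
      map_zero' := by
        ext f
        exact map_zero (show C →ₗ[S] N from f)
      map_add' := fun c c' => by
        ext f
        exact map_add (show C →ₗ[S] N from f) c c' })
    (fun _ _ _ => rfl)

/-- The Bass class `B_C(S)`. -/
structure InBassClass : Prop where
  ext_vanish : ExtVanish S C N
  tor_vanish : TorVanish R C (BHom R S C N)
  eval_bijective : Function.Bijective (evalMap R S C N)

end Bimodule

/-! ### `C`-`fp_n`-flat modules and dimension -/

/-- The left `R`-module `Y` is `fp_n`-flat: `K ⊗_R Y → L ⊗_R Y` is injective for every injective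
homomorphism `K → L` of finitely `n`-presented right `R`-modules. -/
def IsFpFlat (n : ℕ) (R : Type u) [Ring R] (Y : Type u) [AddCommGroup Y] [Module R Y] : Prop :=
  ∀ (K L : ModuleCat.{u} Rᵐᵒᵖ) (f : K →ₗ[Rᵐᵒᵖ] L), FinPresented n Rᵐᵒᵖ K →
    FinPresented n Rᵐᵒᵖ L → Function.Injective f → Function.Injective (Tens.map Y f)

/-- An exact sequence `0 → X_k → ⋯ → X_1 → X_0 → N → 0` of left `S`-modules
(extended by `X_i = 0` for `i > k`). -/
structure LeftRes (S : Type u) [Ring S] (N : Type u) [AddCommGroup N] [Module S N] (k : ℕ) where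
  X : ℕ → ModuleCat.{u} S
  d : ∀ i, X (i + 1) →ₗ[S] X i
  aug : X 0 →ₗ[S] N
  aug_surjective : Function.Surjective aug
  exact_zero : Function.Exact (d 0) aug
  exact_succ : ∀ i, Function.Exact (d (i + 1)) (d i)
  bounded : ∀ i, k < i → Subsingleton (X i)

section Flat

variable (n : ℕ) (R S : Type u) [Ring R] [Ring S]
variable (C : Type u) [AddCommGroup C] [Module S C] [Module Rᵐᵒᵖ C] [SMulCommClass S Rᵐᵒᵖ C]
variable (N : Type u) [AddCommGroup N] [Module S N]

/-- The left `S`-module `N` is `C`-`fp_n`-flat: `N ≅ C ⊗_R Y` for an `fp_n`-flat `R`-module `Y`. -/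
def IsCFpFlat : Prop :=
  ∃ Y : ModuleCat.{u} R, IsFpFlat n R Y ∧ Nonempty (N ≃ₗ[S] Tens R C Y)

/-- The `C`-`fp_n`-flat dimension of `N`: the least `j` such that there is an exact sequence
`0 → F_j → ⋯ → F_0 → N → 0` with all `F_i` being `C`-`fp_n`-flat (and `∞` if there is none). -/
def cfpFlatDim : ℕ∞ :=
  sInf {m : ℕ∞ | ∃ j : ℕ, m = j ∧ ∃ F : LeftRes S N j, ∀ i ≤ j, IsCFpFlat n R S C (F.X i)}

end Flat

end Foxby

end

/-! The theorem is transported along H = Hom_S(C, -), which turns it into a dimension-shifting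
argument for Tor over R.

Under coherence of Rᵒᵖ, an R-module is fp_n-flat exactly when its Tor_1 against every finitely
n-presented right module M vanishes (`isFpFlat_iff`). Such M have syzygies of the same kind, so all
higher Tor vanish as well (`IsFpFlat.torSuccVanish`).

For fp_n-flat Y the unit Y → H(C ⊗ Y) is bijective (`bhomUnit_bijective`) and Ext_S^i(C, C ⊗ Y) = 0
for i ≥ 1. Both come from comparing Hom_S(M, C) ⊗ Y with Hom_S(M, C ⊗ Y) along a finite projective
resolution of M = C. Hence C-fp_n-flat modules lie in the Bass class (`isBass_tens`), and a Bass
module X is C-fp_n-flat if and only if H(X) is fp_n-flat (`IsBass.isCFpFlat_iff`).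

The kernel of a surjection of Bass modules is again Bass, and H stays exact on such a sequence
(`IsBass.map_surjective`, `IsBass.kernel`). The surjectivity is where faithfulness of C enters. So H
carries a resolution of N to an exact sequence ending in H(N) whose terms in degrees below k are
fp_n-flat. Shifting dimensions, N_k is C-fp_n-flat if and only if Tor_{k+1}(M, H(N)) = 0 for every
finitely n-presented M (`LeftRes.isBass_and_isFpFlat_iff`). This condition does not mention the
resolution, so if one resolution has a good last term then all do.

Conversely, partial resolutions always exist (`IsBass.exists_leftRes`), and shorter resolutions can
be padded by zero (`cfpFlatDim_le_iff`).

Vanishing of Tor is handled through exactness statements and syzygies; the derived functor occurs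
only when the Bass class hypothesis is translated (`TorVanish.torSuccVanish`). -/

namespace Foxby

/-! ### Closure properties of finitely n-presented modules. -/

section FinPresented

variable {A : Type u} [Ring A]
variable {K L M : Type u} [AddCommGroup K] [AddCommGroup L] [AddCommGroup M]
variable [Module A K] [Module A L] [Module A M]

theorem finPresented_zero_iff : FinPresented 0 A M ↔ Module.Finite A M := by
  constructor
  · rintro ⟨r, d, p, hp, -, -⟩
    exact Module.Finite.of_surjective p hp
  · intro h
    obtain ⟨r, p, hp⟩ := Module.Finite.exists_fin' A M
    exact ⟨fun _ => r, fun _ => 0, p, hp, fun h => absurd h (lt_irrefl 0),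
      fun i hi => absurd hi (Nat.not_lt_zero _)⟩

/-- Removing or restoring the degree-zero term shifts the sequence by one. This recursion is what
allows the closure properties below to be proved by induction on n. -/
theorem finPresented_succ_iff {n : ℕ} : FinPresented (n + 1) A M ↔
    ∃ (r : ℕ) (g : (Fin r → A) →ₗ[A] M), Function.Surjective g ∧
      FinPresented n A (LinearMap.ker g) := by
  constructor
  · rintro ⟨r, d, p, hp, h0, hd⟩
    have h0 := h0 n.succ_pos
    have hk : ∀ x, d 0 x ∈ LinearMap.ker p := fun x => (h0 _).2 ⟨x, rfl⟩
    refine ⟨r 0, p, hp, fun i => r (i + 1), fun i => d (i + 1), (d 0).codRestrict _ hk, ?_, ?_, ?_⟩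
    · rintro ⟨y, hy⟩
      obtain ⟨x, hx⟩ := (h0 y).1 hy
      exact ⟨x, Subtype.ext hx⟩
    · intro hn y
      rw [← hd 0 (by omega) y]
      exact Subtype.ext_iff
    · exact fun i hi => hd (i + 1) (by omega)
  · rintro ⟨s, g, hg, r, d, p, hp, h0, hd⟩
    refine ⟨fun i => Nat.rec s (fun i _ => r i) i,
      fun i => match i with
        | 0 => (LinearMap.ker g).subtype ∘ₗ p
        | i + 1 => d i, g, hg, ?_, ?_⟩
    · intro _ y
      constructor
      · intro hy
        obtain ⟨x, hx⟩ := hp ⟨y, hy⟩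
        exact ⟨x, congrArg Subtype.val hx⟩
      · rintro ⟨x, rfl⟩
        exact (p x).2
    · rintro (_ | i) hi y
      · exact (Subtype.ext_iff (a1 := p y) (a2 := 0)).symm.trans (h0 (by omega) y)
      · exact hd i (by omega) y

theorem FinPresented.finite {n : ℕ} (h : FinPresented n A M) : Module.Finite A M := by
  obtain ⟨r, d, p, hp, -, -⟩ := h
  exact Module.Finite.of_surjective p hp

theorem FinPresented.of_equiv {n : ℕ} (e : L ≃ₗ[A] M) (h : FinPresented n A L) :
    FinPresented n A M := by
  obtain ⟨r, d, p, hp, h0, hd⟩ := h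
  refine ⟨r, d, e.toLinearMap ∘ₗ p, e.surjective.comp hp, fun hn y => ?_, hd⟩
  rw [← h0 hn y]
  exact e.map_eq_zero_iff

theorem FinPresented.of_succ {n : ℕ} (h : FinPresented (n + 1) A M) : FinPresented n A M := by
  obtain ⟨r, d, p, hp, h0, hd⟩ := h
  exact ⟨r, d, p, hp, fun _ => h0 n.succ_pos, fun i hi => hd i (by omega)⟩

/-- Finitely `n`-presented modules are closed under extensions. -/
theorem FinPresented.extension {n : ℕ} {K L M : Type u} [AddCommGroup K] [AddCommGroup L]
    [AddCommGroup M] [Module A K] [Module A L] [Module A M] {f : K →ₗ[A] L} {g : L →ₗ[A] M}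
    (hf : Function.Injective f) (hfg : Function.Exact f g) (hg : Function.Surjective g)
    (hK : FinPresented n A K) (hM : FinPresented n A M) : FinPresented n A L := by
  induction n generalizing K L M with
  | zero =>
    rw [finPresented_zero_iff] at *
    exact Module.Finite.of_exact hfg hg
  | succ n ih =>
    obtain ⟨r, p, hp, hpk⟩ := finPresented_succ_iff.1 hK
    obtain ⟨s, q, hq, hqk⟩ := finPresented_succ_iff.1 hM
    obtain ⟨t, ht⟩ := Module.projective_lifting_property g q hg
    have ht' : ∀ x, g (t x) = q x := fun x => LinearMap.congr_fun ht x
    have hgf : ∀ x, g (f x) = 0 := fun x => (hfg _).2 ⟨x, rfl⟩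
    -- Horseshoe construction: covers of the two ends, the right one lifted through `g`, combine to
    -- a cover of the middle.
    let w₀ : ((Fin r → A) × (Fin s → A)) →ₗ[A] L := (f ∘ₗ p).coprod t
    have hw₀ : Function.Surjective w₀ := by
      intro y
      obtain ⟨b, hb⟩ := hq (g y)
      obtain ⟨x, hx⟩ := (hfg (y - t b)).1 (by simp [ht', hb])
      obtain ⟨a, rfl⟩ := hp x
      exact ⟨(a, b), by simp [w₀, hx]⟩
    let e : (Fin (r + s) → A) ≃ₗ[A] ((Fin r → A) × (Fin s → A)) :=
      (LinearEquiv.funCongrLeft A A finSumFinEquiv).trans (LinearEquiv.sumArrowLequivProdArrow _ _ A A)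
    -- The three kernels again form a short exact sequence, to which the induction hypothesis
    -- applies.
    have h₀ : FinPresented n A (LinearMap.ker w₀) := by
      refine ih (K := LinearMap.ker p) (M := LinearMap.ker q)
        (f := ((LinearMap.inl A (Fin r → A) (Fin s → A)) ∘ₗ (LinearMap.ker p).subtype).codRestrict _
          (fun x => by simp [w₀]))
        (g := ((LinearMap.snd A (Fin r → A) (Fin s → A)) ∘ₗ (LinearMap.ker w₀).subtype).codRestrict _
          (fun x => ?_)) ?_ ?_ ?_ hpk hqk
      · have := x.2
        simp only [w₀, LinearMap.mem_ker] at this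
        have hg0 := congrArg g this
        rwa [LinearMap.coprod_apply, map_add, LinearMap.comp_apply, hgf, ht', zero_add,
          map_zero] at hg0
      · intro x y hxy
        have := congrArg (fun z => z.1.1) hxy
        exact Subtype.ext this
      · rintro ⟨⟨a, b⟩, hab⟩
        constructor
        · intro h
          have hb : b = 0 := congrArg Subtype.val h
          subst hb
          have : f (p a) = 0 := by simpa [w₀] using hab
          exact ⟨⟨a, hf (by simpa using this)⟩, rfl⟩
        · rintro ⟨x, hx⟩
          have := congrArg (fun z => z.1.2) hx
          exact Subtype.ext this.symm
      · rintro ⟨b, hb⟩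
        obtain ⟨x, hx⟩ := (hfg (t b)).1 (by rw [ht']; exact hb)
        obtain ⟨a, rfl⟩ := hp x
        exact ⟨⟨(-a, b), by simp [w₀, hx]⟩, rfl⟩
    refine finPresented_succ_iff.2 ⟨r + s, w₀ ∘ₗ e.toLinearMap, hw₀.comp e.surjective, ?_⟩
    refine h₀.of_equiv (LinearEquiv.ofSubmodule' e (LinearMap.ker w₀)).symm

/-- A cokernel of a finitely `n`-presented submodule of a finitely `(n+1)`-presented module. -/
theorem FinPresented.cokernel {n : ℕ} {f : K →ₗ[A] L} {g : L →ₗ[A] M}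
    (hf : Function.Injective f) (hfg : Function.Exact f g) (hg : Function.Surjective g)
    (hK : FinPresented n A K) (hL : FinPresented (n + 1) A L) : FinPresented (n + 1) A M := by
  obtain ⟨r, p, hp, hpk⟩ := finPresented_succ_iff.1 hL
  refine finPresented_succ_iff.2 ⟨r, g ∘ₗ p, hg.comp hp, ?_⟩
  have hle : LinearMap.ker p ≤ LinearMap.ker (g ∘ₗ p) := fun x hx => by
    simp [LinearMap.mem_ker.1 hx]
  have hr : ∀ x : LinearMap.ker (g ∘ₗ p), p x ∈ LinearMap.range f := fun x => (hfg _).1 x.2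
  -- The new syzygy ker(g ∘ p) is an extension of `K` by ker p, where `q` is `p` followed by the
  -- inverse of `f` on its image.
  let q : LinearMap.ker (g ∘ₗ p) →ₗ[A] K :=
    (LinearEquiv.ofInjective f hf).symm.toLinearMap ∘ₗ
      (p ∘ₗ (LinearMap.ker (g ∘ₗ p)).subtype).codRestrict _ hr
  have hq : ∀ x, f (q x) = p x := fun x =>
    congrArg Subtype.val ((LinearEquiv.ofInjective f hf).apply_symm_apply ⟨p x, hr x⟩)
  refine FinPresented.extension (f := Submodule.inclusion hle) (g := q)
    (Submodule.inclusion_injective hle) ?_ ?_ hpk hK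
  · intro x
    constructor
    · intro hx
      exact ⟨⟨x, by rw [LinearMap.mem_ker, ← hq, hx, map_zero]⟩, rfl⟩
    · rintro ⟨y, rfl⟩
      refine hf ?_
      rw [hq, map_zero]
      exact y.2
  · intro k
    obtain ⟨x, hx⟩ := hp (f k)
    refine ⟨⟨x, ?_⟩, hf ?_⟩
    · rw [LinearMap.mem_ker, LinearMap.comp_apply, hx]
      exact (hfg _).2 ⟨k, rfl⟩
    · rw [hq, hx]

theorem FinPresented.cokernel_of_both {n : ℕ} {f : K →ₗ[A] L} {g : L →ₗ[A] M}
    (hf : Function.Injective f) (hfg : Function.Exact f g) (hg : Function.Surjective g)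
    (hK : FinPresented n A K) (hL : FinPresented n A L) : FinPresented n A M := by
  cases n with
  | zero =>
    have := hL.finite
    exact finPresented_zero_iff.2 (Module.Finite.of_surjective g hg)
  | succ n => exact hK.of_succ.cokernel hf hfg hg hL

/-- A retract of a module which is finitely `n`-presented for all `n`. -/
theorem FinPresented.retract (hL : ∀ n, FinPresented n A L) (g : L →ₗ[A] M) (s : M →ₗ[A] L)
    (hgs : ∀ x, g (s x) = x) (n : ℕ) : FinPresented n A M := by
  induction n generalizing M with
  | zero =>
    have := (hL 0).finite
    exact finPresented_zero_iff.2 (Module.Finite.of_surjective g fun x => ⟨s x, hgs x⟩)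
  | succ n ih =>
    refine FinPresented.cokernel (f := (LinearMap.ker g).subtype) (g := g)
      Subtype.val_injective (LinearMap.exact_subtype_ker_map g) (fun x => ⟨s x, hgs x⟩) ?_
      (hL (n + 1))
    -- The complementary summand ker g is itself a retract of `L`, so the induction runs over all
    -- retracts at once.
    refine ih ((LinearMap.id - s ∘ₗ g).codRestrict _ fun x => by simp [hgs])
      (LinearMap.ker g).subtype fun x => Subtype.ext ?_
    simp

theorem finPresented_of_subsingleton [Subsingleton M] (n : ℕ) : FinPresented n A M := by
  induction n generalizing M with
  | zero => exact finPresented_zero_iff.2 inferInstance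
  | succ n ih =>
    refine finPresented_succ_iff.2 ⟨0, 0, fun x => ⟨0, Subsingleton.elim _ _⟩, ih⟩

theorem finPresented_pi (hM : ∀ n, FinPresented n A M) (r n : ℕ) :
    FinPresented n A (Fin r → M) := by
  induction r with
  | zero => exact finPresented_of_subsingleton n
  | succ r ih =>
    refine FinPresented.extension (f := LinearMap.single A (fun _ : Fin (r + 1) => M) 0)
      (g := LinearMap.funLeft A M Fin.succ)
      (Pi.single_injective (M := fun _ : Fin (r + 1) => M) 0) ?_ ?_ (hM n) ih
    · intro x
      constructor
      · intro hx
        refine ⟨x 0, funext fun i => ?_⟩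
        refine Fin.cases ?_ (fun j => ?_) i
        · simp
        · simpa using (congrFun hx j).symm
      · rintro ⟨y, rfl⟩
        ext j
        simp [LinearMap.funLeft]
    · intro x
      exact ⟨Fin.cons 0 x, rfl⟩

theorem finPresented_self (n : ℕ) : FinPresented n A A := by
  cases n with
  | zero => exact finPresented_zero_iff.2 inferInstance
  | succ n =>
    let e := LinearEquiv.funUnique (Fin 1) A A
    have : Subsingleton (LinearMap.ker e.toLinearMap) := by
      rw [LinearEquiv.ker]
      infer_instance
    exact finPresented_succ_iff.2 ⟨1, e.toLinearMap, e.surjective, finPresented_of_subsingleton n⟩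

/-- A finite dual basis of a finitely generated projective module. -/
theorem exists_dual_basis [Module.Finite A M] [Module.Projective A M] :
    ∃ (r : ℕ) (p : Fin r → M) (φ : Fin r → M →ₗ[A] A), ∀ x, ∑ i, φ i x • p i = x := by
  obtain ⟨r, g, hg⟩ := Module.Finite.exists_fin' A M
  obtain ⟨s, hs⟩ := Module.projective_lifting_property g LinearMap.id hg
  refine ⟨r, fun i => g (Pi.single i 1), fun i => LinearMap.proj i ∘ₗ s, fun x => ?_⟩
  conv_rhs => rw [← LinearMap.id_apply (R := A) x, ← hs, LinearMap.comp_apply,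
    pi_eq_sum_univ' (s x), map_sum]
  refine Finset.sum_congr rfl fun i _ => ?_
  rw [map_smul]
  congr 2

theorem finPresented_of_projective [Module.Finite A M] [Module.Projective A M] (n : ℕ) :
    FinPresented n A M := by
  obtain ⟨r, g, hg⟩ := Module.Finite.exists_fin' A M
  obtain ⟨s, hs⟩ := Module.projective_lifting_property g LinearMap.id hg
  exact FinPresented.retract (finPresented_pi finPresented_self r) g s
    (fun x => LinearMap.congr_fun hs x) n

/-- The first syzygy in a degreewise finite projective resolution. -/
theorem HasDegreewiseFiniteProjRes.exists_syzygy (h : HasDegreewiseFiniteProjRes A M) :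
    ∃ (P : Type u) (_ : AddCommGroup P) (_ : Module A P) (g : P →ₗ[A] M),
      Module.Finite A P ∧ Module.Projective A P ∧ Function.Surjective g ∧
        HasDegreewiseFiniteProjRes A (LinearMap.ker g) := by
  obtain ⟨P, d, p, hP, hp, h0, hd⟩ := h
  have hk : ∀ x, d 0 x ∈ LinearMap.ker p := fun x => (h0 _).2 ⟨x, rfl⟩
  refine ⟨P 0, inferInstance, inferInstance, p, (hP 0).1, (hP 0).2, hp, fun i => P (i + 1),
    fun i => d (i + 1), (d 0).codRestrict _ hk, fun i => hP (i + 1), ?_, ?_, fun i => hd (i + 1)⟩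
  · rintro ⟨y, hy⟩
    obtain ⟨x, hx⟩ := (h0 y).1 hy
    exact ⟨x, Subtype.ext hx⟩
  · intro y
    rw [← hd 0 y]
    exact Subtype.ext_iff

/-- Finite presentation asks for free modules while the resolution is only projective; this is
bridged because finitely generated projectives are finitely n-presented for every n and cokernels
preserve the property. -/
theorem HasDegreewiseFiniteProjRes.finPresented (h : HasDegreewiseFiniteProjRes A M) (n : ℕ) :
    FinPresented n A M := by
  induction n generalizing M with
  | zero =>
    obtain ⟨P, _, _, g, _, _, hg, -⟩ := h.exists_syzygy
    exact finPresented_zero_iff.2 (Module.Finite.of_surjective g hg)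
  | succ n ih =>
    obtain ⟨P, _, _, g, _, _, hg, h'⟩ := h.exists_syzygy
    exact (ih h').cokernel Subtype.val_injective (LinearMap.exact_subtype_ker_map g) hg
      (finPresented_of_projective (n + 1))

end FinPresented

/-! ### A diagram chase used for balancing Tor. -/

section ThreeByThree

variable {A₁ A₂ A₃ B₁ B₂ B₃ D₁ D₂ : Type*} [AddCommGroup A₁] [AddCommGroup A₂] [AddCommGroup A₃]
  [AddCommGroup B₁] [AddCommGroup B₂] [AddCommGroup B₃] [AddCommGroup D₁] [AddCommGroup D₂]

/-- A diagram chase: injectivity of the third column gives injectivity of the third row. -/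
theorem injective_of_three_by_three {a₁ : A₁ →+ A₂} {a₂ : A₂ →+ A₃} {b₁ : B₁ →+ B₂} {b₂ : B₂ →+ B₃}
    {c₁ : D₁ →+ D₂} {u₁ : A₁ →+ B₁} {u₂ : A₂ →+ B₂} {u₃ : A₃ →+ B₃} {v₁ : B₁ →+ D₁} {v₂ : B₂ →+ D₂}
    (ha : Function.Exact a₁ a₂) (hb : Function.Exact b₁ b₂) (hu : Function.Exact u₁ v₁)
    (hv : Function.Exact u₂ v₂) (hv₁ : Function.Surjective v₁) (hb₁ : Function.Injective b₁)
    (h₁ : ∀ x, b₁ (u₁ x) = u₂ (a₁ x)) (h₂ : ∀ x, v₂ (b₁ x) = c₁ (v₁ x))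
    (h₃ : ∀ x, u₃ (a₂ x) = b₂ (u₂ x)) (hu₃ : Function.Injective u₃) : Function.Injective c₁ := by
  refine (injective_iff_map_eq_zero c₁).2 fun x hx => ?_
  obtain ⟨y, rfl⟩ := hv₁ x
  obtain ⟨k, hk⟩ := (hv (b₁ y)).1 ((h₂ y).trans hx)
  have hk0 : a₂ k = 0 := hu₃ (by rw [h₃, hk, map_zero]; exact (hb _).2 ⟨y, rfl⟩)
  obtain ⟨k', rfl⟩ := (ha k).1 hk0
  exact (hu y).2 ⟨k', hb₁ ((h₁ k').trans hk)⟩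

end ThreeByThree

/-! ### Right exactness of the tensor product, and exactness for projective factors. -/

section Tens

variable {R : Type u} [Ring R]
variable {X : Type u} [AddCommGroup X] [Module Rᵐᵒᵖ X]
variable {X' : Type u} [AddCommGroup X'] [Module Rᵐᵒᵖ X']
variable {X'' : Type u} [AddCommGroup X''] [Module Rᵐᵒᵖ X'']
variable {Y : Type u} [AddCommGroup Y] [Module R Y]
variable {Y' : Type u} [AddCommGroup Y'] [Module R Y']
variable {Y'' : Type u} [AddCommGroup Y''] [Module R Y'']
variable {A : Type u} [AddCommGroup A]

/-- The map out of `X ⊗_R Y` given by a balanced biadditive function. -/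
noncomputable def Tens.liftFun (b : X → Y → A) (h₁ : ∀ x x' y, b (x + x') y = b x y + b x' y)
    (h₂ : ∀ x y y', b x (y + y') = b x y + b x y')
    (h₃ : ∀ (x : X) (r : R) (y : Y), b (op r • x) y = b x (r • y)) : Tens R X Y →+ A :=
  Tens.lift (AddMonoidHom.toIntLinearMap
    (AddMonoidHom.mk' (fun x => AddMonoidHom.toIntLinearMap (AddMonoidHom.mk' (b x) (h₂ x)))
      fun x x' => LinearMap.ext (h₁ x x'))) h₃

variable (R) in
theorem Tens.tmul_zero (x : X) : Tens.tmul R x (0 : Y) = 0 := by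
  simpa using Tens.tmul_add (R := R) x (0 : Y) 0

variable (R) in
theorem Tens.zero_tmul (y : Y) : Tens.tmul R (0 : X) y = 0 := by
  simpa using Tens.add_tmul (R := R) (0 : X) 0 y

theorem Tens.induction_on {p : Tens R X Y → Prop} (t : Tens R X Y) (zero : p 0)
    (tmul : ∀ x y, p (Tens.tmul R x y)) (add : ∀ s t, p s → p t → p (s + t)) : p t := by
  induction t using Submodule.Quotient.induction_on with
  | H t =>
    induction t using TensorProduct.induction_on with
    | zero => exact zero
    | tmul x y => exact tmul x y
    | add a b ha hb => exact add _ _ ha hb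

variable (X) in
/-- The map `X ⊗ g : X ⊗_R Y → X ⊗_R Y'`. -/
noncomputable def Tens.mapR (g : Y →ₗ[R] Y') : Tens R X Y →+ Tens R X Y' :=
  Tens.liftFun (fun x y => Tens.tmul R x (g y)) (fun x x' y => Tens.add_tmul x x' _)
    (fun x y y' => by rw [_root_.map_add, Tens.tmul_add])
    (fun x r y => by rw [map_smul, Tens.tmul_balanced])

@[simp] theorem Tens.mapR_tmul (g : Y →ₗ[R] Y') (x : X) (y : Y) :
    Tens.mapR X g (Tens.tmul R x y) = Tens.tmul R x (g y) := rfl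

theorem Tens.mapR_comp_apply (g : Y' →ₗ[R] Y'') (f : Y →ₗ[R] Y') (t : Tens R X Y) :
    Tens.mapR X (g ∘ₗ f) t = Tens.mapR X g (Tens.mapR X f t) :=
  DFunLike.congr_fun (Tens.hom_ext (f := Tens.mapR X (g ∘ₗ f))
    (g := (Tens.mapR X g).comp (Tens.mapR X f)) fun _ _ => rfl) t

theorem Tens.mapR_id_apply (t : Tens R X Y) : Tens.mapR X LinearMap.id t = t :=
  DFunLike.congr_fun (Tens.hom_ext (f := Tens.mapR X (LinearMap.id : Y →ₗ[R] Y))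
    (g := AddMonoidHom.id _) fun _ _ => rfl) t

theorem Tens.map_comp_apply (g : X' →ₗ[Rᵐᵒᵖ] X'') (f : X →ₗ[Rᵐᵒᵖ] X') (t : Tens R X Y) :
    Tens.map Y (g ∘ₗ f) t = Tens.map Y g (Tens.map Y f t) :=
  DFunLike.congr_fun (Tens.map_comp g f) t

theorem Tens.map_mapR (f : X →ₗ[Rᵐᵒᵖ] X') (g : Y →ₗ[R] Y') (t : Tens R X Y) :
    Tens.map Y' f (Tens.mapR X g t) = Tens.mapR X' g (Tens.map Y f t) :=
  DFunLike.congr_fun (Tens.hom_ext (f := (Tens.map Y' f).comp (Tens.mapR X g))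
    (g := (Tens.mapR X' g).comp (Tens.map Y f)) fun _ _ => rfl) t

theorem Tens.mapR_smul {S : Type u} [Ring S] [Module S X] [SMulCommClass S Rᵐᵒᵖ X]
    (g : Y →ₗ[R] Y') (s : S) (t : Tens R X Y) :
    Tens.mapR X g (s • t) = s • Tens.mapR X g t :=
  (Tens.map_mapR (Module.toModuleEnd Rᵐᵒᵖ X s) g t).symm

theorem Tens.mapR_injective_of_equiv (e : Y ≃ₗ[R] Y') :
    Function.Injective (Tens.mapR X e.toLinearMap) :=
  Function.LeftInverse.injective (g := Tens.mapR X e.symm.toLinearMap) fun t => by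
    rw [← Tens.mapR_comp_apply, LinearEquiv.symm_comp, Tens.mapR_id_apply]

variable (X) in
/-- An isomorphism `Y ≃ Y'` induces an `S`-linear isomorphism `X ⊗_R Y ≃ X ⊗_R Y'`. -/
noncomputable def Tens.congrR (S : Type u) [Ring S] [Module S X] [SMulCommClass S Rᵐᵒᵖ X]
    (e : Y ≃ₗ[R] Y') : Tens R X Y ≃ₗ[S] Tens R X Y' where
  toFun := Tens.mapR X e.toLinearMap
  map_add' := _root_.map_add _
  map_smul' := Tens.mapR_smul _
  invFun := Tens.mapR X e.symm.toLinearMap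
  left_inv t := by
    rw [← Tens.mapR_comp_apply, LinearEquiv.symm_comp, Tens.mapR_id_apply]
  right_inv t := by
    rw [← Tens.mapR_comp_apply, LinearEquiv.comp_symm, Tens.mapR_id_apply]

theorem Tens.mapR_surjective {g : Y →ₗ[R] Y'} (hg : Function.Surjective g) :
    Function.Surjective (Tens.mapR X g) := by
  intro t
  induction t using Tens.induction_on with
  | zero => exact ⟨0, map_zero _⟩
  | tmul x y =>
    obtain ⟨z, rfl⟩ := hg y
    exact ⟨Tens.tmul R x z, rfl⟩
  | add a b ha hb =>
    obtain ⟨a', rfl⟩ := ha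
    obtain ⟨b', rfl⟩ := hb
    exact ⟨a' + b', _root_.map_add _ _ _⟩

theorem Tens.map_surjective {f : X →ₗ[Rᵐᵒᵖ] X'} (hf : Function.Surjective f) :
    Function.Surjective (Tens.map Y f) := by
  intro t
  induction t using Tens.induction_on with
  | zero => exact ⟨0, map_zero _⟩
  | tmul x y =>
    obtain ⟨z, rfl⟩ := hf x
    exact ⟨Tens.tmul R z y, rfl⟩
  | add a b ha hb =>
    obtain ⟨a', rfl⟩ := ha
    obtain ⟨b', rfl⟩ := hb
    exact ⟨a' + b', _root_.map_add _ _ _⟩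

theorem Tens.mapR_exact {f : Y →ₗ[R] Y'} {g : Y' →ₗ[R] Y''} (hfg : Function.Exact f g)
    (hg : Function.Surjective g) : Function.Exact (Tens.mapR X f) (Tens.mapR X g) := by
  intro t
  constructor
  · intro ht
    let q := QuotientAddGroup.mk' (Tens.mapR X f).range
    have hq : ∀ (x : X) (y z : Y'), g y = g z → q (Tens.tmul R x y) = q (Tens.tmul R x z) := by
      intro x y z h
      obtain ⟨w, hw⟩ := (hfg (z - y)).1 (by rw [map_sub, h, sub_self])
      refine QuotientAddGroup.eq.2 ⟨Tens.tmul R x w, ?_⟩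
      rw [Tens.mapR_tmul, eq_neg_add_iff_add_eq, ← Tens.tmul_add, hw, add_sub_cancel]
    -- A set-theoretic section suffices: by `hq`, modulo the image of X ⊗ f a pure tensor depends
    -- only on the image of its second factor under `g`. This gives an inverse on the cokernel.
    let s := Function.surjInv hg
    have hs : ∀ y, g (s y) = y := Function.surjInv_eq hg
    let b : Tens R X Y'' →+ (Tens R X Y' ⧸ (Tens.mapR X f).range) :=
      Tens.liftFun (fun x y => q (Tens.tmul R x (s y)))
        (fun x x' y => by rw [Tens.add_tmul, _root_.map_add])
        (fun x y y' => by
          rw [← _root_.map_add, ← Tens.tmul_add]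
          exact hq _ _ _ (by simp [hs]))
        (fun x r y => by
          rw [Tens.tmul_balanced]
          exact hq _ _ _ (by simp [hs]))
    have hb : ∀ t, b (Tens.mapR X g t) = q t := fun t =>
      DFunLike.congr_fun (Tens.hom_ext (f := b.comp (Tens.mapR X g)) (g := q)
        fun x y => hq _ _ _ (hs _)) t
    have := hb t
    rw [ht, map_zero] at this
    exact (QuotientAddGroup.eq_zero_iff t).1 this.symm
  · rintro ⟨t, rfl⟩
    rw [← Tens.mapR_comp_apply, hfg.linearMap_comp_eq_zero]
    exact DFunLike.congr_fun (Tens.hom_ext (f := Tens.mapR X (0 : Y →ₗ[R] Y'')) (g := 0)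
      fun x y => Tens.tmul_zero R x) t

theorem Tens.map_exact {f : X →ₗ[Rᵐᵒᵖ] X'} {g : X' →ₗ[Rᵐᵒᵖ] X''} (hfg : Function.Exact f g)
    (hg : Function.Surjective g) : Function.Exact (Tens.map Y f) (Tens.map Y g) := by
  intro t
  constructor
  · intro ht
    let q := QuotientAddGroup.mk' (Tens.map Y f).range
    have hq : ∀ (y z : X') (x : Y), g y = g z → q (Tens.tmul R y x) = q (Tens.tmul R z x) := by
      intro y z x h
      obtain ⟨w, hw⟩ := (hfg (z - y)).1 (by rw [map_sub, h, sub_self])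
      refine QuotientAddGroup.eq.2 ⟨Tens.tmul R w x, ?_⟩
      rw [Tens.map_tmul, eq_neg_add_iff_add_eq, ← Tens.add_tmul, hw, add_sub_cancel]
    let s := Function.surjInv hg
    have hs : ∀ y, g (s y) = y := Function.surjInv_eq hg
    let b : Tens R X'' Y →+ (Tens R X' Y ⧸ (Tens.map Y f).range) :=
      Tens.liftFun (fun x y => q (Tens.tmul R (s x) y))
        (fun x x' y => by
          rw [← _root_.map_add, ← Tens.add_tmul]
          exact hq _ _ _ (by simp [hs]))
        (fun x y y' => by rw [Tens.tmul_add, _root_.map_add])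
        (fun x r y => by
          rw [← Tens.tmul_balanced]
          exact hq _ _ _ (by simp [hs]))
    have hb : ∀ t, b (Tens.map Y g t) = q t := fun t =>
      DFunLike.congr_fun (Tens.hom_ext (f := b.comp (Tens.map Y g)) (g := q)
        fun x y => hq _ _ _ (hs _)) t
    have := hb t
    rw [ht, map_zero] at this
    exact (QuotientAddGroup.eq_zero_iff t).1 this.symm
  · rintro ⟨t, rfl⟩
    rw [← Tens.map_comp_apply, hfg.linearMap_comp_eq_zero]
    exact DFunLike.congr_fun (Tens.hom_ext (f := Tens.map Y (0 : X →ₗ[Rᵐᵒᵖ] X'')) (g := 0)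
      fun x y => Tens.zero_tmul R y) t

/-- Tensoring with a projective left module preserves injectivity. -/
theorem Tens.map_injective_of_projective [Module.Projective R Y] {f : X →ₗ[Rᵐᵒᵖ] X'}
    (hf : Function.Injective f) : Function.Injective (Tens.map Y f) := by
  obtain ⟨s, hs⟩ := (Module.projective_def' (R := R) (P := Y)).1 inferInstance
  have hs' : ∀ y, ((s y).sum fun z r => r • z) = y := fun y => LinearMap.congr_fun hs y
  -- The splitting `s` embeds `Y` in a free module, so X ⊗ Y embeds naturally in a direct sum of
  -- copies of X, where injectivity is checked coordinatewise.
  let c : ∀ (X : Type u) [AddCommGroup X] [Module Rᵐᵒᵖ X], Tens R X Y →+ (Y →₀ X) := fun X _ _ =>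
    Tens.liftFun (fun x y => (s y).mapRange (fun r => op r • x) (by simp))
      (fun x x' y => by ext; simp) (fun x y y' => by ext; simp [add_smul])
      (fun x r y => by ext; simp [mul_smul])
  have hc : ∀ (X : Type u) [AddCommGroup X] [Module Rᵐᵒᵖ X], Function.Injective (c X) := by
    intro X _ _
    let ρ : (Y →₀ X) →+ Tens R X Y := Finsupp.liftAddHom fun y =>
      AddMonoidHom.mk' (fun x => Tens.tmul R x y) fun x x' => Tens.add_tmul x x' y
    have hρ : ∀ t, ρ (c X t) = t := by
      intro t
      refine DFunLike.congr_fun (Tens.hom_ext (f := ρ.comp (c X)) (g := AddMonoidHom.id _)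
        fun x y => ?_) t
      change Finsupp.sum (Finsupp.mapRange (fun r : R => op r • x) (by simp) (s y))
        (fun y x => Tens.tmul R x y) = Tens.tmul R x y
      rw [Finsupp.sum_mapRange_index (fun y => Tens.zero_tmul R y)]
      conv_rhs => rw [← hs' y]
      let τ : Y →+ Tens R X Y := AddMonoidHom.mk' (fun y => Tens.tmul R x y) (Tens.tmul_add x)
      refine Eq.trans ?_ (map_finsuppSum τ (s y) (fun z r => r • z)).symm
      exact Finsupp.sum_congr fun z _ => Tens.tmul_balanced R x _ z
    exact Function.LeftInverse.injective hρ
  have hn : ∀ t, c X' (Tens.map Y f t) = (c X t).mapRange f (map_zero f) := by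
    intro t
    refine DFunLike.congr_fun (Tens.hom_ext (f := (c X').comp (Tens.map Y f))
      (g := (Finsupp.mapRange.addMonoidHom f.toAddMonoidHom).comp (c X)) fun x y => ?_) t
    ext z
    change op (s y z) • f x = f (op (s y z) • x)
    rw [map_smul]
  intro a b hab
  refine hc X (Finsupp.mapRange_injective f (map_zero f) hf ?_)
  rw [← hn, ← hn, hab]

/-- Tensoring with a projective right module preserves injectivity. -/
theorem Tens.mapR_injective_of_projective [Module.Projective Rᵐᵒᵖ X] {f : Y →ₗ[R] Y'}
    (hf : Function.Injective f) : Function.Injective (Tens.mapR X f) := by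
  obtain ⟨s, hs⟩ := (Module.projective_def' (R := Rᵐᵒᵖ) (P := X)).1 inferInstance
  have hs' : ∀ y, ((s y).sum fun z r => r • z) = y := fun y => LinearMap.congr_fun hs y
  let c : ∀ (Y : Type u) [AddCommGroup Y] [Module R Y], Tens R X Y →+ (X →₀ Y) := fun Y _ _ =>
    Tens.liftFun (fun x y => (s x).mapRange (fun r => unop r • y) (by simp))
      (fun x x' y => by ext; simp [add_smul]) (fun x y y' => by ext; simp)
      (fun x r y => by ext; simp [mul_smul])
  have hc : ∀ (Y : Type u) [AddCommGroup Y] [Module R Y], Function.Injective (c Y) := by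
    intro Y _ _
    let ρ : (X →₀ Y) →+ Tens R X Y := Finsupp.liftAddHom fun x =>
      AddMonoidHom.mk' (fun y => Tens.tmul R x y) fun y y' => Tens.tmul_add x y y'
    have hρ : ∀ t, ρ (c Y t) = t := by
      intro t
      refine DFunLike.congr_fun (Tens.hom_ext (f := ρ.comp (c Y)) (g := AddMonoidHom.id _)
        fun x y => ?_) t
      change Finsupp.sum (Finsupp.mapRange (fun r : Rᵐᵒᵖ => unop r • y) (by simp) (s x))
        (fun x y => Tens.tmul R x y) = Tens.tmul R x y
      rw [Finsupp.sum_mapRange_index (fun x => Tens.tmul_zero R x)]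
      conv_rhs => rw [← hs' x]
      let τ : X →+ Tens R X Y := AddMonoidHom.mk' (fun x => Tens.tmul R x y)
        (fun x x' => Tens.add_tmul x x' y)
      refine Eq.trans ?_ (map_finsuppSum τ (s x) (fun z r => r • z)).symm
      exact Finsupp.sum_congr fun z _ => (Tens.tmul_balanced R z (unop (s x z)) y).symm
    exact Function.LeftInverse.injective hρ
  have hn : ∀ t, c Y' (Tens.mapR X f t) = (c Y t).mapRange f (map_zero f) := by
    intro t
    refine DFunLike.congr_fun (Tens.hom_ext (f := (c Y').comp (Tens.mapR X f))
      (g := (Finsupp.mapRange.addMonoidHom f.toAddMonoidHom).comp (c Y)) fun x y => ?_) t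
    ext z
    change unop (s x z) • f y = f (unop (s x z) • y)
    rw [map_smul]
  intro a b hab
  refine hc Y (Finsupp.mapRange_injective f (map_zero f) hf ?_)
  rw [← hn, ← hn, hab]

end Tens

/-! ### Vanishing of Tor_1 and its symmetry in the two variables. -/

section TorOne

variable (R : Type u) [Ring R]

/-- The vanishing of `Tor_1^R(M, H)`, formulated by exactness. -/
def TorOneVanish (M : Type u) [AddCommGroup M] [Module Rᵐᵒᵖ M]
    (H : Type u) [AddCommGroup H] [Module R H] : Prop :=
  ∀ (K L : Type u) [AddCommGroup K] [AddCommGroup L] [Module Rᵐᵒᵖ K] [Module Rᵐᵒᵖ L]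
    (f : K →ₗ[Rᵐᵒᵖ] L) (g : L →ₗ[Rᵐᵒᵖ] M), Function.Injective f → Function.Exact f g →
    Function.Surjective g → Function.Injective (Tens.map H f)

theorem exists_projective_cover (A : Type u) [Ring A] (M : Type u) [AddCommGroup M] [Module A M] :
    ∃ (P : Type u) (_ : AddCommGroup P) (_ : Module A P) (g : P →ₗ[A] M),
      Module.Projective A P ∧ Function.Surjective g :=
  ⟨M →₀ A, inferInstance, inferInstance, Finsupp.linearCombination A id, inferInstance,
    Finsupp.linearCombination_id_surjective A M⟩

variable {R}
variable {K L M : Type u} [AddCommGroup K] [AddCommGroup L] [AddCommGroup M]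
variable [Module Rᵐᵒᵖ K] [Module Rᵐᵒᵖ L] [Module Rᵐᵒᵖ M]
variable {H' G H : Type u} [AddCommGroup H'] [AddCommGroup G] [AddCommGroup H]
variable [Module R H'] [Module R G] [Module R H]
variable {f : K →ₗ[Rᵐᵒᵖ] L} {g : L →ₗ[Rᵐᵒᵖ] M} {a : H' →ₗ[R] G} {b : G →ₗ[R] H}

theorem TorOneVanish.of_mapR_injective (hab : Function.Exact a b) (hb : Function.Surjective b)
    (hG : TorOneVanish R M G) (h : Function.Injective (Tens.mapR M a)) : TorOneVanish R M H := by
  intro K L _ _ _ _ f g hf hfg hg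
  exact injective_of_three_by_three (a₁ := Tens.map H' f) (a₂ := Tens.map H' g)
    (b₁ := Tens.map G f) (b₂ := Tens.map G g) (u₁ := Tens.mapR K a) (u₂ := Tens.mapR L a)
    (u₃ := Tens.mapR M a) (v₁ := Tens.mapR K b) (v₂ := Tens.mapR L b)
    (Tens.map_exact hfg hg) (Tens.map_exact hfg hg) (Tens.mapR_exact hab hb)
    (Tens.mapR_exact hab hb) (Tens.mapR_surjective hb) (hG K L f g hf hfg hg)
    (Tens.map_mapR f a) (fun t => (Tens.map_mapR f b t).symm) (fun t => (Tens.map_mapR g a t).symm) h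

/-- The three-by-three chase with rows and columns exchanged; it carries injectivity from the first
variable to the second. -/
theorem mapR_injective_of_map_injective (hfg : Function.Exact f g) (hg : Function.Surjective g)
    (hab : Function.Exact a b) (hb : Function.Surjective b)
    (hL : Function.Injective (Tens.mapR L a)) (h : Function.Injective (Tens.map H f)) :
    Function.Injective (Tens.mapR M a) :=
  injective_of_three_by_three (a₁ := Tens.mapR K a) (a₂ := Tens.mapR K b)
    (b₁ := Tens.mapR L a) (b₂ := Tens.mapR L b) (u₁ := Tens.map H' f) (u₂ := Tens.map G f)
    (u₃ := Tens.map H f) (v₁ := Tens.map H' g) (v₂ := Tens.map G g)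
    (Tens.mapR_exact hab hb) (Tens.mapR_exact hab hb) (Tens.map_exact hfg hg)
    (Tens.map_exact hfg hg) (Tens.map_surjective hg) hL
    (fun t => (Tens.map_mapR f a t).symm) (Tens.map_mapR g a) (Tens.map_mapR f b) h

theorem torOneVanish_of_projective [Module.Projective R H] : TorOneVanish R M H :=
  fun _ _ _ _ _ _ _ _ hf _ _ => Tens.map_injective_of_projective hf

theorem TorOneVanish.mapR_injective (h : TorOneVanish R M H) (ha : Function.Injective a)
    (hab : Function.Exact a b) (hb : Function.Surjective b) :
    Function.Injective (Tens.mapR M a) := by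
  obtain ⟨P, _, _, g, _, hg⟩ := exists_projective_cover Rᵐᵒᵖ M
  have hfg := LinearMap.exact_subtype_ker_map g
  exact mapR_injective_of_map_injective hfg hg hab hb (Tens.mapR_injective_of_projective ha)
    (h _ _ _ g Subtype.val_injective hfg hg)

/-- A single presentation with projective middle term decides vanishing: pass to a projective
presentation of `H` and back. Injectivity of `f` itself is not needed. -/
theorem TorOneVanish.of_presentation [Module.Projective Rᵐᵒᵖ L] (hfg : Function.Exact f g)
    (hg : Function.Surjective g) (h : Function.Injective (Tens.map H f)) :
    TorOneVanish R M H := by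
  obtain ⟨F, _, _, b, _, hb⟩ := exists_projective_cover R H
  have hab := LinearMap.exact_subtype_ker_map b
  exact TorOneVanish.of_mapR_injective hab hb torOneVanish_of_projective
    (mapR_injective_of_map_injective hfg hg hab hb
      (Tens.mapR_injective_of_projective Subtype.val_injective) h)

/-- Dimension shifting: `Tor_1(K, H)` and `Tor_1(M, H')` both agree with `Tor_2(M, H)`. -/
theorem torOneVanish_shift [Module.Projective Rᵐᵒᵖ L] (hf : Function.Injective f)
    (hfg : Function.Exact f g) (hg : Function.Surjective g) (ha : Function.Injective a)
    (hab : Function.Exact a b) (hb : Function.Surjective b) (hM : TorOneVanish R M G)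
    (hK : TorOneVanish R K G) : TorOneVanish R K H ↔ TorOneVanish R M H' := by
  have hG := hM K L f g hf hfg hg
  have hL : Function.Injective (Tens.mapR L a) := Tens.mapR_injective_of_projective ha
  have hc : (Tens.map G f ∘ Tens.mapR K a) = (Tens.mapR L a ∘ Tens.map H' f) :=
    funext (Tens.map_mapR f a)
  constructor
  · intro h
    refine TorOneVanish.of_presentation hfg hg (Function.Injective.of_comp (f := Tens.mapR L a) ?_)
    rw [← hc]
    exact hG.comp (h.mapR_injective ha hab hb)
  · intro h
    refine TorOneVanish.of_mapR_injective hab hb hK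
      (Function.Injective.of_comp (f := Tens.map G f) ?_)
    rw [hc]
    exact hL.comp (h K L f g hf hfg hg)

end TorOne

/-! ### Higher Tor and dimension shifting in either variable. -/

section TorSucc

/-- The vanishing of `Tor_{k+1}^R(M, H)`, formulated by dimension shifting in `H`. -/
def TorSuccVanish (R : Type u) [Ring R] : ℕ → (M : Type u) → [AddCommGroup M] → [Module Rᵐᵒᵖ M] →
    (H : Type u) → [AddCommGroup H] → [Module R H] → Prop
  | 0, M, _, _, H, _, _ => TorOneVanish R M H
  | k + 1, M, _, _, H, _, _ => ∀ (H' F : Type u) [AddCommGroup H'] [AddCommGroup F] [Module R H']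
      [Module R F] [Module.Projective R F] (a : H' →ₗ[R] F) (b : F →ₗ[R] H),
      Function.Injective a → Function.Exact a b → Function.Surjective b → TorSuccVanish R k M H'

variable {R : Type u} [Ring R]

/-- The definition shifts in `H`; balance of Tor lets the shift be made in `M` instead. It also
shows that the choice of projective presentation of `H` is immaterial. -/
theorem torSuccVanish_succ_iff_left {K L M H : Type u} [AddCommGroup K] [AddCommGroup L]
    [AddCommGroup M] [Module Rᵐᵒᵖ K] [Module Rᵐᵒᵖ L] [Module Rᵐᵒᵖ M] [AddCommGroup H] [Module R H]
    {f : K →ₗ[Rᵐᵒᵖ] L} {g : L →ₗ[Rᵐᵒᵖ] M} [Module.Projective Rᵐᵒᵖ L] (hf : Function.Injective f)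
    (hfg : Function.Exact f g) (hg : Function.Surjective g) (k : ℕ) :
    TorSuccVanish R (k + 1) M H ↔ TorSuccVanish R k K H := by
  induction k generalizing H with
  | zero =>
    constructor
    · intro h
      obtain ⟨F, _, _, b, _, hb⟩ := exists_projective_cover R H
      have hab := LinearMap.exact_subtype_ker_map b
      exact (torOneVanish_shift hf hfg hg Subtype.val_injective hab hb torOneVanish_of_projective
        torOneVanish_of_projective).2 (h _ F _ b Subtype.val_injective hab hb)
    · intro h H' F _ _ _ _ _ a b ha hab hb
      exact (torOneVanish_shift hf hfg hg ha hab hb torOneVanish_of_projective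
        torOneVanish_of_projective).1 h
  | succ k ih =>
    constructor
    · intro h H' F _ _ _ _ _ a b ha hab hb
      exact ih.1 (h H' F a b ha hab hb)
    · intro h H' F _ _ _ _ _ a b ha hab hb
      exact ih.2 (h H' F a b ha hab hb)

/-- The middle term only has to be Tor-acyclic against `M`, so fp_n-flat modules can replace
projectives in resolutions. The induction passes to a syzygy of `M`, against which `G` is still
acyclic. -/
theorem torSuccVanish_succ_iff_right {M H' G H : Type u} [AddCommGroup M] [Module Rᵐᵒᵖ M]
    [AddCommGroup H'] [AddCommGroup G] [AddCommGroup H] [Module R H'] [Module R G] [Module R H]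
    {a : H' →ₗ[R] G} {b : G →ₗ[R] H} (hG : ∀ j, TorSuccVanish R j M G) (ha : Function.Injective a)
    (hab : Function.Exact a b) (hb : Function.Surjective b) (k : ℕ) :
    TorSuccVanish R (k + 1) M H ↔ TorSuccVanish R k M H' := by
  induction k generalizing M with
  | zero =>
    obtain ⟨P, _, _, g, _, hg⟩ := exists_projective_cover Rᵐᵒᵖ M
    have hfg := LinearMap.exact_subtype_ker_map g
    rw [torSuccVanish_succ_iff_left Subtype.val_injective hfg hg]
    exact torOneVanish_shift Subtype.val_injective hfg hg ha hab hb (hG 0)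
      ((torSuccVanish_succ_iff_left Subtype.val_injective hfg hg 0).1 (hG 1))
  | succ k ih =>
    obtain ⟨P, _, _, g, _, hg⟩ := exists_projective_cover Rᵐᵒᵖ M
    have hfg := LinearMap.exact_subtype_ker_map g
    rw [torSuccVanish_succ_iff_left Subtype.val_injective hfg hg,
      torSuccVanish_succ_iff_left Subtype.val_injective hfg hg]
    exact ih fun j => (torSuccVanish_succ_iff_left Subtype.val_injective hfg hg j).1 (hG (j + 1))

theorem TorOneVanish.of_equiv {M H H' : Type u} [AddCommGroup M] [Module Rᵐᵒᵖ M]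
    [AddCommGroup H] [AddCommGroup H'] [Module R H] [Module R H'] (e : H ≃ₗ[R] H')
    (h : TorOneVanish R M H) : TorOneVanish R M H' := by
  intro K L _ _ _ _ f g hf hfg hg
  have hc : (Tens.mapR L e.symm.toLinearMap ∘ Tens.map H' f) =
      (Tens.map H f ∘ Tens.mapR K e.symm.toLinearMap) :=
    funext fun t => (Tens.map_mapR f e.symm.toLinearMap t).symm
  refine Function.Injective.of_comp (f := Tens.mapR L e.symm.toLinearMap) ?_
  rw [hc]
  exact (h K L f g hf hfg hg).comp (Tens.mapR_injective_of_equiv e.symm)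

theorem TorSuccVanish.of_equiv {k : ℕ} {M H H' : Type u} [AddCommGroup M] [Module Rᵐᵒᵖ M]
    [AddCommGroup H] [AddCommGroup H'] [Module R H] [Module R H'] (e : H ≃ₗ[R] H')
    (h : TorSuccVanish R k M H) : TorSuccVanish R k M H' := by
  cases k with
  | zero => exact TorOneVanish.of_equiv e h
  | succ k =>
    intro H₁ F _ _ _ _ _ a b ha hab hb
    refine h H₁ F a (e.symm.toLinearMap ∘ₗ b) ha (fun x => ?_) (e.symm.surjective.comp hb)
    rw [← hab x]
    exact e.symm.map_eq_zero_iff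

end TorSucc

/-! ### fp_n-flat modules as Tor-acyclic modules. -/

section FpFlat

variable {n : ℕ} {R : Type u} [Ring R] {Y Y' : Type u} [AddCommGroup Y] [Module R Y]
  [AddCommGroup Y'] [Module R Y']

theorem isFpFlat_of_projective [Module.Projective R Y] : IsFpFlat n R Y :=
  fun _ _ _ _ _ hf => Tens.map_injective_of_projective hf

/-- Coherence makes the syzygy of `M` in a finite free module finitely n-presented, so flatness can
be tested on that inclusion. Conversely, the cokernel of an injection of finitely n-presented
modules is finitely n-presented. -/
theorem isFpFlat_iff (hR : IsNCoherent n Rᵐᵒᵖ) : IsFpFlat n R Y ↔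
    ∀ (M : Type u) [AddCommGroup M] [Module Rᵐᵒᵖ M], FinPresented n Rᵐᵒᵖ M →
      TorOneVanish R M Y := by
  constructor
  · intro hY M _ _ hM
    obtain ⟨r, g, hg, hk⟩ := finPresented_succ_iff.1 (hR (ModuleCat.of _ M) hM)
    exact TorOneVanish.of_presentation (LinearMap.exact_subtype_ker_map g) hg
      (hY (ModuleCat.of _ (LinearMap.ker g)) (ModuleCat.of _ (Fin r → Rᵐᵒᵖ))
        (LinearMap.ker g).subtype hk (finPresented_of_projective n) Subtype.val_injective)
  · intro h K L f hK hL hf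
    have hM : FinPresented n Rᵐᵒᵖ (L ⧸ LinearMap.range f) :=
      FinPresented.cokernel_of_both hf (LinearMap.exact_map_mkQ_range f)
        (Submodule.mkQ_surjective _) hK hL
    exact h _ hM K L f _ hf (LinearMap.exact_map_mkQ_range f) (Submodule.mkQ_surjective _)

theorem IsFpFlat.torSuccVanish (hR : IsNCoherent n Rᵐᵒᵖ) (hY : IsFpFlat n R Y) {M : Type u}
    [AddCommGroup M] [Module Rᵐᵒᵖ M] (hM : FinPresented n Rᵐᵒᵖ M) (k : ℕ) :
    TorSuccVanish R k M Y := by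
  induction k generalizing M with
  | zero => exact (isFpFlat_iff hR).1 hY M hM
  | succ k ih =>
    obtain ⟨r, g, hg, hk⟩ := finPresented_succ_iff.1 (hR (ModuleCat.of _ M) hM)
    exact (torSuccVanish_succ_iff_left Subtype.val_injective (LinearMap.exact_subtype_ker_map g)
      hg k).2 (ih hk)

theorem IsFpFlat.of_equiv (e : Y ≃ₗ[R] Y') (hY : IsFpFlat n R Y) : IsFpFlat n R Y' := by
  intro K L f hK hL hf
  have hc : (Tens.mapR L e.symm.toLinearMap ∘ Tens.map Y' f) =
      (Tens.map Y f ∘ Tens.mapR K e.symm.toLinearMap) :=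
    funext fun t => (Tens.map_mapR f e.symm.toLinearMap t).symm
  refine Function.Injective.of_comp (f := Tens.mapR L e.symm.toLinearMap) ?_
  rw [hc]
  exact (hY K L f hK hL hf).comp (Tens.mapR_injective_of_equiv e.symm)

end FpFlat

/-! ### From the derived functor Tor to the elementary vanishing condition. -/

section TorFunctor

variable {R : Type u} [Ring R]

/-- If tensoring with `H` keeps a projective resolution of `C` exact in positive degrees, then all
the higher `Tor(C, H)` vanish. -/
theorem torSuccVanish_of_resolution {C H : Type u} [AddCommGroup C] [Module Rᵐᵒᵖ C]
    [AddCommGroup H] [Module R H] (P : ℕ → ModuleCat.{u} Rᵐᵒᵖ) (d : ∀ i, P (i + 1) →ₗ[Rᵐᵒᵖ] P i)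
    (p : P 0 →ₗ[Rᵐᵒᵖ] C) (hP : ∀ i, Module.Projective Rᵐᵒᵖ (P i)) (hp : Function.Surjective p)
    (h0 : Function.Exact (d 0) p) (hd : ∀ i, Function.Exact (d (i + 1)) (d i))
    (hH : ∀ i, Function.Exact (Tens.map H (d (i + 1))) (Tens.map H (d i))) (k : ℕ) :
    TorSuccVanish R k C H := by
  have hex : ∀ i, Function.Exact (LinearMap.range (d (i + 1))).subtype (d i).rangeRestrict := by
    intro i x
    rw [Subtype.ext_iff]
    refine (hd i x).trans ?_
    simp
  -- Lift an element to P_{i+1} ⊗ H. If it dies in P_i ⊗ H it comes from P_{i+2} ⊗ H, and hence was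
  -- already zero.
  have hinj : ∀ i, Function.Injective (Tens.map H (LinearMap.range (d i)).subtype) := by
    intro i
    refine (injective_iff_map_eq_zero _).2 fun t ht => ?_
    obtain ⟨y, rfl⟩ := Tens.map_surjective (d i).surjective_rangeRestrict t
    rw [← Tens.map_comp_apply] at ht
    obtain ⟨z, rfl⟩ := (hH i y).1 ht
    rw [← Tens.map_comp_apply]
    have : (d i).rangeRestrict ∘ₗ d (i + 1) = 0 :=
      LinearMap.ext fun x => Subtype.ext ((hd i _).2 ⟨x, rfl⟩)
    rw [this]
    exact DFunLike.congr_fun (Tens.hom_ext (f := Tens.map H (0 : P (i + 2) →ₗ[Rᵐᵒᵖ] _)) (g := 0)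
      fun x y => Tens.zero_tmul R y) z
  have hsyz : ∀ k i, TorSuccVanish R k (LinearMap.range (d i)) H := by
    intro k
    induction k with
    | zero =>
      exact fun i => TorOneVanish.of_presentation (hex i) (d i).surjective_rangeRestrict
        (hinj (i + 1))
    | succ k ih =>
      exact fun i => (torSuccVanish_succ_iff_left Subtype.val_injective (hex i)
        (d i).surjective_rangeRestrict k).2 (ih (i + 1))
  have hex0 : Function.Exact (LinearMap.range (d 0)).subtype p := fun x =>
    (h0 x).trans (by simp)
  cases k with
  | zero => exact TorOneVanish.of_presentation hex0 hp (hinj 0)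
  | succ k =>
    exact (torSuccVanish_succ_iff_left Subtype.val_injective hex0 hp k).2 (hsyz k 0)

theorem TorVanish.torSuccVanish {C H : Type u} [AddCommGroup C] [Module Rᵐᵒᵖ C]
    [AddCommGroup H] [Module R H] (h : TorVanish R C H) (k : ℕ) : TorSuccVanish R k C H := by
  let Q := ProjectiveResolution.of (ModuleCat.of Rᵐᵒᵖ C)
  refine torSuccVanish_of_resolution (fun i => Q.complex.X i)
    (fun i => (Q.complex.d (i + 1) i).hom) (Q.π.f 0).hom ?_ ?_ ?_ ?_ ?_ k
  · intro i
    exact (IsProjective.iff_projective _).2 (Q.projective i)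
  · exact (ModuleCat.epi_iff_surjective _).1 inferInstance
  · exact (ShortComplex.ShortExact.moduleCat_exact_iff_function_exact _).1 Q.exact₀
  · intro i
    exact (ShortComplex.ShortExact.moduleCat_exact_iff_function_exact _).1 (Q.exact_succ i)
  · intro i
    have hs : Subsingleton (((tensFunctor R H).leftDerived (i + 1)).obj (ModuleCat.of Rᵐᵒᵖ C)) :=
      h (i + 1) (by omega)
    have hz := (ModuleCat.isZero_of_subsingleton _).of_iso
      (Q.isoLeftDerivedObj (tensFunctor R H) (i + 1)).symm
    have he := (HomologicalComplex.exactAt_iff_isZero_homology _ _).2 hz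
    rw [HomologicalComplex.exactAt_iff' _ (i + 2) (i + 1) i (by simp) (by simp)] at he
    exact (ShortComplex.ShortExact.moduleCat_exact_iff_function_exact _).1 he

end TorFunctor

/-! ### Vanishing of Ext through syzygies and lifting problems. -/

section Ext

open Abelian

variable {A : Type u} [Ring A]
variable {K P M X : Type u} [AddCommGroup K] [AddCommGroup P] [AddCommGroup M] [AddCommGroup X]
variable [Module A K] [Module A P] [Module A M] [Module A X]
variable {f : K →ₗ[A] P} {g : P →ₗ[A] M}

theorem shortExact_of_exact (hf : Function.Injective f) (hfg : Function.Exact f g)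
    (hg : Function.Surjective g) :
    (ShortComplex.mk (ModuleCat.ofHom f) (ModuleCat.ofHom g)
      (ModuleCat.hom_ext hfg.linearMap_comp_eq_zero)).ShortExact where
  exact := (ShortComplex.ShortExact.moduleCat_exact_iff_function_exact _).2 hfg
  mono_f := (ModuleCat.mono_iff_injective _).2 hf
  epi_g := (ModuleCat.epi_iff_surjective _).2 hg

theorem subsingleton_ext_of_projective [Module.Projective A P] (i : ℕ) :
    Subsingleton (Ext (ModuleCat.of A P) (ModuleCat.of A X) (i + 1)) := by
  have : CategoryTheory.Projective (ModuleCat.of A P) :=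
    (IsProjective.iff_projective _).1 inferInstance
  exact Ext.subsingleton_of_projective _ _ i

theorem subsingleton_ext_one_iff [Module.Projective A P] (hf : Function.Injective f)
    (hfg : Function.Exact f g) (hg : Function.Surjective g) :
    Subsingleton (Ext (ModuleCat.of A M) (ModuleCat.of A X) 1) ↔
      ∀ u : K →ₗ[A] X, ∃ v : P →ₗ[A] X, v ∘ₗ f = u := by
  have hS := shortExact_of_exact hf hfg hg
  have hP := subsingleton_ext_of_projective (A := A) (P := P) (X := X)
  constructor
  · intro h u
    obtain ⟨v, hv⟩ := Ext.contravariant_sequence_exact₁ hS _ (Ext.mk₀ (ModuleCat.ofHom u))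
      (add_zero 1) (Subsingleton.elim _ _)
    obtain ⟨v, rfl⟩ := (Ext.mk₀_bijective _ _).2 v
    rw [Ext.mk₀_comp_mk₀] at hv
    exact ⟨v.hom, congrArg ModuleCat.Hom.hom ((Ext.mk₀_bijective _ _).1 hv)⟩
  · intro h
    refine subsingleton_of_forall_eq 0 fun z => ?_
    obtain ⟨u, rfl⟩ := Ext.contravariant_sequence_exact₃ hS _ z ((hP 0).elim _ _) (add_zero 1)
    obtain ⟨u, rfl⟩ := (Ext.mk₀_bijective _ _).2 u
    obtain ⟨v, hv⟩ := h u.hom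
    have hu : u = ModuleCat.ofHom f ≫ ModuleCat.ofHom v := ModuleCat.hom_ext hv.symm
    rw [hu, ← Ext.mk₀_comp_mk₀]
    exact hS.extClass_comp_assoc _

theorem subsingleton_ext_add_two_iff [Module.Projective A P] (hf : Function.Injective f)
    (hfg : Function.Exact f g) (hg : Function.Surjective g) (i : ℕ) :
    Subsingleton (Ext (ModuleCat.of A M) (ModuleCat.of A X) (i + 2)) ↔
      Subsingleton (Ext (ModuleCat.of A K) (ModuleCat.of A X) (i + 1)) := by
  have hS := shortExact_of_exact hf hfg hg
  have hP := subsingleton_ext_of_projective (A := A) (P := P) (X := X)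
  constructor
  · intro h
    refine subsingleton_of_forall_eq 0 fun x => ?_
    obtain ⟨v, rfl⟩ := Ext.contravariant_sequence_exact₁ hS _ x
      (show 1 + (i + 1) = i + 2 by omega) (Subsingleton.elim _ _)
    rw [(hP i).elim v 0, Ext.comp_zero]
  · intro h
    refine subsingleton_of_forall_eq 0 fun z => ?_
    obtain ⟨u, rfl⟩ := Ext.contravariant_sequence_exact₃ hS _ z ((hP (i + 1)).elim _ _)
      (show 1 + (i + 1) = i + 2 by omega)
    rw [Subsingleton.elim u 0, Ext.comp_zero]

/-- By the covariant long exact sequence only degree 1 needs care: such a class is the connecting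
image of a map X → M, which is zero once that map lifts through `g`. -/
theorem ExtVanish.kernel (hf : Function.Injective f)
    (hfg : Function.Exact f g) (hg : Function.Surjective g) (hP : ExtVanish A X P)
    (hM : ExtVanish A X M) (h : ∀ u : X →ₗ[A] M, ∃ v : X →ₗ[A] P, g ∘ₗ v = u) :
    ExtVanish A X K := by
  have hS := shortExact_of_exact hf hfg hg
  rintro (_ | i) hi
  · omega
  have := hP (i + 1) hi
  refine subsingleton_of_forall_eq 0 fun x => ?_
  obtain ⟨z, rfl⟩ := Ext.covariant_sequence_exact₁ _ hS x (Subsingleton.elim _ _) rfl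
  cases i with
  | zero =>
    obtain ⟨u, rfl⟩ := (Ext.mk₀_bijective _ _).2 z
    obtain ⟨v, hv⟩ := h u.hom
    have hu : u = ModuleCat.ofHom v ≫ ModuleCat.ofHom g := ModuleCat.hom_ext hv.symm
    rw [hu, ← Ext.mk₀_comp_mk₀]
    rw [Ext.comp_assoc_of_second_deg_zero]
    rw [hS.comp_extClass, Ext.comp_zero]
  | succ i =>
    have := hM (i + 1) (by omega)
    rw [Subsingleton.elim z 0, Ext.zero_comp]

theorem ExtVanish.of_equiv (e : P ≃ₗ[A] M) (h : ExtVanish A X P) : ExtVanish A X M := by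
  intro i hi
  have := h i hi
  refine subsingleton_of_forall_eq 0 fun x => ?_
  have he : ModuleCat.ofHom e.symm.toLinearMap ≫ ModuleCat.ofHom e.toLinearMap = 𝟙 _ :=
    ModuleCat.hom_ext (by simp)
  rw [← Ext.comp_mk₀_id x, ← he, ← Ext.mk₀_comp_mk₀, ← Ext.comp_assoc_of_second_deg_zero,
    Subsingleton.elim (x.comp _ _) 0, Ext.zero_comp]

end Ext

/-! ### Tensor evaluation: Hom_S(M, C) ⊗ Y compared with Hom_S(M, C ⊗ Y). -/

section HomTens

variable {R S : Type u} [Ring R] [Ring S]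
variable {C : Type u} [AddCommGroup C] [Module S C] [Module Rᵐᵒᵖ C] [SMulCommClass S Rᵐᵒᵖ C]
variable {M P K : Type u} [AddCommGroup M] [Module S M] [AddCommGroup P] [Module S P]
  [AddCommGroup K] [Module S K]
variable {Y : Type u} [AddCommGroup Y] [Module R Y]

variable (R S C) in
/-- The `S`-linear map `c ↦ c ⊗ y`. -/
noncomputable def tmulHom (y : Y) : C →ₗ[S] Tens R C Y where
  toFun c := Tens.tmul R c y
  map_add' c c' := Tens.add_tmul c c' y
  map_smul' _ _ := rfl

theorem tmulHom_add (y y' : Y) : tmulHom R S C (y + y') = tmulHom R S C y + tmulHom R S C y' :=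
  LinearMap.ext fun c => Tens.tmul_add c y y'

variable (R S C Y M) in
/-- The natural map `Hom_S(M, C) ⊗_R Y → Hom_S(M, C ⊗_R Y)`. -/
noncomputable def homTens : Tens R (M →ₗ[S] C) Y →+ (M →ₗ[S] Tens R C Y) :=
  Tens.liftFun (fun f y => tmulHom R S C y ∘ₗ f)
    (fun f f' y => LinearMap.comp_add f f' _)
    (fun f y y' => by rw [tmulHom_add, LinearMap.add_comp])
    (fun f r y => LinearMap.ext fun m => Tens.tmul_balanced R (f m) r y)

variable (R C) in
/-- Precomposition as a right `R`-linear map. -/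
def precomp (h : K →ₗ[S] M) : (M →ₗ[S] C) →ₗ[Rᵐᵒᵖ] (K →ₗ[S] C) where
  toFun f := f ∘ₗ h
  map_add' _ _ := rfl
  map_smul' _ _ := rfl

theorem homTens_precomp (h : K →ₗ[S] M) (t : Tens R (M →ₗ[S] C) Y) :
    homTens R S C K Y (Tens.map Y (precomp R C h) t) = homTens R S C M Y t ∘ₗ h := by
  let c : (M →ₗ[S] Tens R C Y) →+ (K →ₗ[S] Tens R C Y) :=
    AddMonoidHom.mk' (fun f => f ∘ₗ h) fun _ _ => rfl
  exact DFunLike.congr_fun (Tens.hom_ext (f := (homTens R S C K Y).comp (Tens.map Y (precomp R C h)))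
    (g := c.comp (homTens R S C M Y)) fun _ _ => rfl) t

variable (R C) in
/-- The right `R`-linear map sending `c` to `x ↦ φ x • c`. -/
def smulRightHom (φ : P →ₗ[S] S) : C →ₗ[Rᵐᵒᵖ] (P →ₗ[S] C) where
  toFun c := φ.smulRight c
  map_add' c c' := by ext; simp
  map_smul' r c := by
    ext x
    exact smul_comm (φ x) r c

theorem homTens_smulRightHom (φ : P →ₗ[S] S) (t : Tens R C Y) (x : P) :
    homTens R S C P Y (Tens.map Y (smulRightHom R C φ) t) x = φ x • t := by
  let c : Tens R C Y →+ Tens R C Y :=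
    AddMonoidHom.mk' (fun t => homTens R S C P Y (Tens.map Y (smulRightHom R C φ) t) x)
      fun a b => by simp only [_root_.map_add, LinearMap.add_apply]
  exact DFunLike.congr_fun (Tens.hom_ext (f := c) (g := DistribSMul.toAddMonoidHom _ (φ x))
    fun _ _ => rfl) t

theorem homTens_bijective_of_projective [Module.Finite S P] [Module.Projective S P] :
    Function.Bijective (homTens R S C P Y) := by
  obtain ⟨r, p, φ, hφ⟩ := exists_dual_basis (A := S) (M := P)
  let inv : (P →ₗ[S] Tens R C Y) →+ Tens R (P →ₗ[S] C) Y :=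
    AddMonoidHom.mk' (fun g => ∑ i, Tens.map Y (smulRightHom R C (φ i)) (g (p i)))
      fun a b => by simp only [LinearMap.add_apply, _root_.map_add, Finset.sum_add_distrib]
  have h₁ : ∀ t, inv (homTens R S C P Y t) = t := fun t => by
    refine DFunLike.congr_fun (Tens.hom_ext (f := inv.comp (homTens R S C P Y))
      (g := AddMonoidHom.id _) fun f y => ?_) t
    let τ : (P →ₗ[S] C) →+ Tens R (P →ₗ[S] C) Y :=
      AddMonoidHom.mk' (fun f => Tens.tmul R f y) fun f f' => Tens.add_tmul f f' y
    change ∑ i, τ (smulRightHom R C (φ i) (f (p i))) = τ f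
    rw [← map_sum]
    congr 1
    ext x
    conv_rhs => rw [← hφ x, map_sum]
    simp [smulRightHom]
  have h₂ : ∀ g, homTens R S C P Y (inv g) = g := fun g => by
    ext x
    change homTens R S C P Y (∑ i, Tens.map Y (smulRightHom R C (φ i)) (g (p i))) x = g x
    rw [map_sum, LinearMap.sum_apply]
    simp only [homTens_smulRightHom]
    conv_rhs => rw [← hφ x, map_sum]
    simp
  exact ⟨Function.LeftInverse.injective h₁, fun g => ⟨inv g, h₂ g⟩⟩

theorem finPresented_hom_of_projective [Module.Finite S P] [Module.Projective S P]
    (hC : ∀ n, FinPresented n Rᵐᵒᵖ C) (n : ℕ) : FinPresented n Rᵐᵒᵖ (P →ₗ[S] C) := by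
  obtain ⟨r, p, φ, hφ⟩ := exists_dual_basis (A := S) (M := P)
  let g : (Fin r → C) →ₗ[Rᵐᵒᵖ] (P →ₗ[S] C) :=
    ∑ i, smulRightHom R C (φ i) ∘ₗ LinearMap.proj i
  let s : (P →ₗ[S] C) →ₗ[Rᵐᵒᵖ] (Fin r → C) :=
    { toFun := fun f i => f (p i)
      map_add' := fun _ _ => rfl
      map_smul' := fun _ _ => rfl }
  refine FinPresented.retract (finPresented_pi hC r) g s (fun f => ?_) n
  ext x
  conv_rhs => rw [← hφ x, map_sum]
  simp [g, s, smulRightHom]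

theorem precomp_injective {g : P →ₗ[S] M} (hg : Function.Surjective g) :
    Function.Injective (precomp R C g) := fun _ _ h => LinearMap.ext fun m => by
  obtain ⟨x, rfl⟩ := hg m
  exact LinearMap.congr_fun h x

theorem exists_comp_eq_of_exact {X : Type u} [AddCommGroup X] [Module S X] {f : K →ₗ[S] P}
    {g : P →ₗ[S] M} (hfg : Function.Exact f g) (hg : Function.Surjective g) (u : P →ₗ[S] X)
    (hu : u ∘ₗ f = 0) : ∃ v : M →ₗ[S] X, v ∘ₗ g = u := by
  have hk : LinearMap.ker g ≤ LinearMap.ker u := fun x hx => by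
    obtain ⟨y, rfl⟩ := (hfg x).1 hx
    exact LinearMap.congr_fun hu y
  let e := g.quotKerEquivOfSurjective hg
  refine ⟨(LinearMap.ker g).liftQ u hk ∘ₗ e.symm.toLinearMap, LinearMap.ext fun x => ?_⟩
  have : e.symm (g x) = Submodule.Quotient.mk x := e.symm_apply_eq.2 rfl
  simp [this]

theorem precomp_exact {f : K →ₗ[S] P} {g : P →ₗ[S] M} (hfg : Function.Exact f g)
    (hg : Function.Surjective g) : Function.Exact (precomp R C g) (precomp R C f) := by
  intro u
  constructor
  · exact exists_comp_eq_of_exact hfg hg u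
  · rintro ⟨v, rfl⟩
    exact LinearMap.ext fun x => (congrArg v ((hfg _).2 ⟨x, rfl⟩)).trans (map_zero v)

/-- Compare with the projective `P`, where tensor evaluation is bijective; fp_n-flatness is applied
to the injection Hom(M, C) → Hom(P, C). -/
theorem homTens_injective {n : ℕ} (hC : ∀ n, FinPresented n Rᵐᵒᵖ C) (hY : IsFpFlat n R Y)
    [Module.Finite S P] [Module.Projective S P] {g : P →ₗ[S] M} (hg : Function.Surjective g)
    (hM : FinPresented n Rᵐᵒᵖ (M →ₗ[S] C)) : Function.Injective (homTens R S C M Y) := by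
  refine Function.Injective.of_comp (f := fun u => u ∘ₗ g) ?_
  have h : (fun u => u ∘ₗ g) ∘ homTens R S C M Y =
      homTens R S C P Y ∘ Tens.map Y (precomp R C g) :=
    funext fun t => (homTens_precomp g t).symm
  rw [h]
  exact homTens_bijective_of_projective.1.comp (hY (ModuleCat.of _ _) (ModuleCat.of _ _)
    (precomp R C g) hM (finPresented_hom_of_projective hC n) (precomp_injective hg))

/-- The hypotheses on `M` under which `Hom_S(M, C) ⊗_R Y ≅ Hom_S(M, C ⊗_R Y)` for all `fp_n`-flat
`Y`. -/
structure IsHomFinite (n : ℕ) (R S C M : Type u) [Ring R] [Ring S] [AddCommGroup C] [Module S C]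
    [Module Rᵐᵒᵖ C] [SMulCommClass S Rᵐᵒᵖ C] [AddCommGroup M] [Module S M] : Prop where
  resolution : HasDegreewiseFiniteProjRes S M
  finPresented_hom : FinPresented n Rᵐᵒᵖ (M →ₗ[S] C)
  ext_vanish : ExtVanish S M C

/-- The hypotheses are inherited by syzygies: since Ext^1(M, C) = 0, Hom(K, C) is the cokernel of
Hom(M, C) → Hom(P, C), and finite n-presentation passes to it. -/
theorem IsHomFinite.exists_syzygy {n : ℕ} (hC : ∀ n, FinPresented n Rᵐᵒᵖ C)
    (h : IsHomFinite n R S C M) :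
    ∃ (P : Type u) (_ : AddCommGroup P) (_ : Module S P) (g : P →ₗ[S] M),
      Module.Finite S P ∧ Module.Projective S P ∧ Function.Surjective g ∧
        IsHomFinite n R S C (LinearMap.ker g) ∧
          Function.Surjective (precomp R C (LinearMap.ker g).subtype) := by
  obtain ⟨P, _, _, g, hfin, hproj, hg, h'⟩ := h.resolution.exists_syzygy
  have hfg := LinearMap.exact_subtype_ker_map g
  have hlift := (subsingleton_ext_one_iff Subtype.val_injective hfg hg).1 (h.ext_vanish 1 le_rfl)
  refine ⟨P, _, _, g, hfin, hproj, hg, ⟨h', ?_, ?_⟩, hlift⟩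
  · exact FinPresented.cokernel_of_both (precomp_injective hg) (precomp_exact hfg hg) hlift
      h.finPresented_hom (finPresented_hom_of_projective hC n)
  · rintro (_ | i) hi
    · omega
    · exact (subsingleton_ext_add_two_iff Subtype.val_injective hfg hg i).1
        (h.ext_vanish (i + 2) (by omega))

theorem IsHomFinite.homTens_bijective {n : ℕ} (hC : ∀ n, FinPresented n Rᵐᵒᵖ C)
    (hY : IsFpFlat n R Y) (h : IsHomFinite n R S C M) :
    Function.Bijective (homTens R S C M Y) := by
  obtain ⟨P, _, _, g, _, _, hg, hK, hlift⟩ := h.exists_syzygy hC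
  have hfg := LinearMap.exact_subtype_ker_map g
  obtain ⟨Q, _, _, q, _, _, hq, -⟩ := hK.resolution.exists_syzygy
  refine ⟨homTens_injective hC hY hg h.finPresented_hom, fun u => ?_⟩
  obtain ⟨t, ht⟩ := (homTens_bijective_of_projective (R := R) (C := C) (Y := Y)).2 (u ∘ₗ g)
  -- Four-lemma argument: injectivity of tensor evaluation for the syzygy shows that `t` restricts
  -- to zero there, so right exactness brings it from Hom(M, C) ⊗ Y.
  have h0 : Tens.map Y (precomp R C (LinearMap.ker g).subtype) t = 0 := by
    refine (injective_iff_map_eq_zero _).1 (homTens_injective hC hY hq hK.finPresented_hom) _ ?_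
    rw [homTens_precomp, ht]
    ext x
    exact (congrArg u x.2).trans (map_zero u)
  obtain ⟨s, rfl⟩ := (Tens.map_exact (precomp_exact hfg hg) hlift t).1 h0
  refine ⟨s, LinearMap.ext fun m => ?_⟩
  obtain ⟨x, rfl⟩ := hg m
  rw [homTens_precomp] at ht
  exact LinearMap.congr_fun ht x

/-- A map from the syzygy to C ⊗ Y comes from Hom(K, C) ⊗ Y, hence from Hom(P, C) ⊗ Y, so it extends
to `P`. Higher degrees follow by passing to syzygies. -/
theorem IsHomFinite.extVanish_tens {n : ℕ} (hC : ∀ n, FinPresented n Rᵐᵒᵖ C)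
    (hY : IsFpFlat n R Y) (h : IsHomFinite n R S C M) : ExtVanish S M (Tens R C Y) := by
  rintro (_ | i) hi
  · omega
  clear hi
  induction i generalizing M with
  | zero =>
    obtain ⟨P, _, _, g, _, _, hg, hK, hlift⟩ := h.exists_syzygy hC
    refine (subsingleton_ext_one_iff Subtype.val_injective (LinearMap.exact_subtype_ker_map g)
      hg).2 fun u => ?_
    obtain ⟨t, rfl⟩ := (hK.homTens_bijective hC hY).2 u
    obtain ⟨s, rfl⟩ := Tens.map_surjective hlift t
    exact ⟨_, (homTens_precomp _ s).symm⟩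
  | succ i ih =>
    obtain ⟨P, _, _, g, _, _, hg, hK, -⟩ := h.exists_syzygy hC
    exact (subsingleton_ext_add_two_iff Subtype.val_injective (LinearMap.exact_subtype_ker_map g)
      hg i).2 (ih hK)

end HomTens

/-! ### Faithfulness of C ⊗ - by character duality. -/

section CharacterDual

/-- The character group `Hom_ℤ(Q, ℚ/ℤ)` of a left `R`-module, as a right `R`-module. -/
def RightCharacter (R Q : Type u) [Ring R] [AddCommGroup Q] [Module R Q] : Type u :=
  CharacterModule Q

variable {R Q : Type u} [Ring R] [AddCommGroup Q] [Module R Q]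

instance : AddCommGroup (RightCharacter R Q) := inferInstanceAs (AddCommGroup (CharacterModule Q))

instance : Module Rᵐᵒᵖ (RightCharacter R Q) where
  smul r χ := AddMonoidHom.comp (show Q →+ AddCircle (1 : ℚ) from χ)
    (DistribSMul.toAddMonoidHom Q (unop r))
  one_smul χ := AddMonoidHom.ext fun q =>
    congrArg (show Q →+ AddCircle (1 : ℚ) from χ) (one_smul R q)
  mul_smul a b χ := AddMonoidHom.ext fun q =>
    congrArg (show Q →+ AddCircle (1 : ℚ) from χ) (mul_smul (unop b) (unop a) q)
  smul_zero _ := AddMonoidHom.zero_comp _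
  smul_add _ _ _ := AddMonoidHom.add_comp _ _ _
  add_smul a b χ := AddMonoidHom.ext fun q =>
    (congrArg (show Q →+ AddCircle (1 : ℚ) from χ) (add_smul (unop a) (unop b) q)).trans
      (map_add (show Q →+ AddCircle (1 : ℚ) from χ) _ _)
  zero_smul χ := AddMonoidHom.ext fun q =>
    (congrArg (show Q →+ AddCircle (1 : ℚ) from χ) (zero_smul R q)).trans
      (map_zero (show Q →+ AddCircle (1 : ℚ) from χ))

theorem subsingleton_of_subsingleton_rightCharacter [Subsingleton (RightCharacter R Q)] :
    Subsingleton Q := by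
  refine subsingleton_of_forall_eq 0 fun q => ?_
  by_contra hq
  obtain ⟨χ, hχ⟩ := CharacterModule.exists_character_apply_ne_zero_of_ne_zero hq
  exact hχ (DFunLike.congr_fun
    (show (χ : Q →+ AddCircle (1 : ℚ)) = 0 from
      Subsingleton.elim (α := RightCharacter R Q) χ 0) q)

/-- If `Hom(C, -)` detects vanishing of right modules, then `C ⊗_R -` detects vanishing of left
modules. -/
theorem subsingleton_of_subsingleton_tens {C : Type u} [AddCommGroup C] [Module Rᵐᵒᵖ C]
    (hC : ∀ M : ModuleCat.{u} Rᵐᵒᵖ, Subsingleton (C →ₗ[Rᵐᵒᵖ] M) → Subsingleton M)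
    [Subsingleton (Tens R C Q)] : Subsingleton Q := by
  have : Subsingleton (RightCharacter R Q) := by
    refine hC (ModuleCat.of _ (RightCharacter R Q)) (subsingleton_of_forall_eq 0 fun h => ?_)
    -- Hom-tensor adjunction: a map from `C` to the character module of `Q` is a character of C ⊗ Q,
    -- which is zero. `ULift` only adjusts the universe.
    have hev : ∀ c, (show Q →+ AddCircle (1 : ℚ) from h c) = 0 := fun c => by
      let b : Tens R C Q →+ ULift.{u} (AddCircle (1 : ℚ)) :=
        Tens.liftFun (fun c q => ULift.up ((show Q →+ AddCircle (1 : ℚ) from h c) q))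
          (fun c c' q => by
            rw [_root_.map_add h]
            rfl)
          (fun c q q' => by
            rw [_root_.map_add]
            rfl)
          (fun c r q => by
            rw [map_smul h]
            rfl)
      ext q
      have hz := congrArg ULift.down (congrArg b (Subsingleton.elim (Tens.tmul R c q) 0))
      rw [_root_.map_zero] at hz
      exact hz
    exact LinearMap.ext hev
  exact subsingleton_of_subsingleton_rightCharacter (R := R)

end CharacterDual

/-! ### The adjunction between C ⊗ - and Hom_S(C, -). -/

section BHom

variable {R S : Type u} [Ring R] [Ring S]
variable {C : Type u} [AddCommGroup C] [Module S C] [Module Rᵐᵒᵖ C] [SMulCommClass S Rᵐᵒᵖ C]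
variable {K G N : Type u} [AddCommGroup K] [Module S K] [AddCommGroup G] [Module S G]
  [AddCommGroup N] [Module S N]
variable {Y : Type u} [AddCommGroup Y] [Module R Y]

variable (R C) in
/-- Postcomposition `Hom_S(C, G) → Hom_S(C, N)` as an `R`-linear map. -/
def BHom.map (g : G →ₗ[S] N) : BHom R S C G →ₗ[R] BHom R S C N where
  toFun u := g ∘ₗ (show C →ₗ[S] G from u)
  map_add' u v := LinearMap.comp_add (show C →ₗ[S] G from u) (show C →ₗ[S] G from v) g
  map_smul' _ _ := rfl

variable (R C) in
/-- The isomorphism `Hom_S(C, G) ≃ Hom_S(C, N)` induced by `G ≃ N`. -/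
def BHom.congr (e : G ≃ₗ[S] N) : BHom R S C G ≃ₗ[R] BHom R S C N :=
  { BHom.map R C e.toLinearMap with
    invFun := BHom.map R C e.symm.toLinearMap
    left_inv := fun _ => LinearMap.ext fun _ => e.symm_apply_apply _
    right_inv := fun _ => LinearMap.ext fun _ => e.apply_symm_apply _ }

theorem BHom.map_injective {f : K →ₗ[S] G} (hf : Function.Injective f) :
    Function.Injective (BHom.map R C f) := fun _ _ h =>
  LinearMap.ext fun c => hf (LinearMap.congr_fun h c)

theorem BHom.map_exact {f : K →ₗ[S] G} {g : G →ₗ[S] N} (hf : Function.Injective f)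
    (hfg : Function.Exact f g) : Function.Exact (BHom.map R C f) (BHom.map R C g) := by
  intro u
  constructor
  · intro hu
    have hr : ∀ c, (show C →ₗ[S] G from u) c ∈ LinearMap.range f := fun c =>
      (hfg _).1 (LinearMap.congr_fun hu c)
    refine ⟨(LinearEquiv.ofInjective f hf).symm.toLinearMap ∘ₗ
      (show C →ₗ[S] G from u).codRestrict _ hr, LinearMap.ext fun c => ?_⟩
    exact congrArg Subtype.val ((LinearEquiv.ofInjective f hf).apply_symm_apply ⟨_, hr c⟩)
  · rintro ⟨v, rfl⟩
    exact LinearMap.ext fun c => (hfg _).2 ⟨_, rfl⟩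

theorem evalMap_mapR (g : G →ₗ[S] N) (t : Tens R C (BHom R S C G)) :
    evalMap R S C N (Tens.mapR C (BHom.map R C g) t) = g (evalMap R S C G t) :=
  DFunLike.congr_fun (Tens.hom_ext (f := (evalMap R S C N).comp (Tens.mapR C (BHom.map R C g)))
    (g := g.toAddMonoidHom.comp (evalMap R S C G)) fun _ _ => rfl) t

theorem evalMap_smul (s : S) (t : Tens R C (BHom R S C N)) :
    evalMap R S C N (s • t) = s • evalMap R S C N t :=
  DFunLike.congr_fun (Tens.hom_ext
    (f := (evalMap R S C N).comp (DistribSMul.toAddMonoidHom _ s))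
    (g := (DistribSMul.toAddMonoidHom _ s).comp (evalMap R S C N))
    fun c u => map_smul (show C →ₗ[S] N from u) s c) t

/-- The evaluation isomorphism `C ⊗_R Hom_S(C, N) ≅ N` as an `S`-linear equivalence. -/
noncomputable def evalEquiv (h : Function.Bijective (evalMap R S C N)) :
    Tens R C (BHom R S C N) ≃ₗ[S] N :=
  LinearEquiv.ofBijective
    { toFun := evalMap R S C N
      map_add' := _root_.map_add _
      map_smul' := evalMap_smul } h

variable (R S C Y) in
/-- The unit `Y → Hom_S(C, C ⊗_R Y)`. -/
noncomputable def bhomUnit : Y →ₗ[R] BHom R S C (Tens R C Y) where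
  toFun y := tmulHom R S C y
  map_add' := tmulHom_add
  map_smul' r y := LinearMap.ext fun c => (Tens.tmul_balanced R c r y).symm

theorem evalMap_bhomUnit (t : Tens R C Y) :
    evalMap R S C (Tens R C Y) (Tens.mapR C (bhomUnit R S C Y) t) = t :=
  DFunLike.congr_fun (Tens.hom_ext
    (f := (evalMap R S C (Tens R C Y)).comp (Tens.mapR C (bhomUnit R S C Y)))
    (g := AddMonoidHom.id _) fun _ _ => rfl) t

/-- Right multiplication identifies `R` with `Hom_S(C, C)` as right `R`-modules. -/
noncomputable def homothetyEquiv (h : Function.Bijective (rightHomothety R S C)) :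
    Rᵐᵒᵖ ≃ₗ[Rᵐᵒᵖ] (C →ₗ[S] C) :=
  LinearEquiv.ofBijective
    { toFun := fun r => rightHomothety R S C (unop r)
      map_add' := fun a b => LinearMap.ext fun c => add_smul a b c
      map_smul' := fun a b => LinearMap.ext fun c => by
        exact mul_smul a b c }
    (h.comp unop_bijective)

theorem tmul_id_bijective (h : Function.Bijective (rightHomothety R S C)) :
    Function.Bijective fun y : Y => Tens.tmul R (LinearMap.id : C →ₗ[S] C) y := by
  let e := homothetyEquiv h
  have he : ∀ r : Rᵐᵒᵖ, e r = r • (LinearMap.id : C →ₗ[S] C) := fun r => rfl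
  let ε : Tens R (C →ₗ[S] C) Y →+ Y :=
    Tens.liftFun (fun f y => unop (e.symm f) • y)
      (fun f f' y => by simp [add_smul]) (fun f y y' => smul_add _ y y')
      (fun f r y => by simp [mul_smul])
  refine Function.bijective_iff_has_inverse.2 ⟨ε, fun y => ?_, fun t => ?_⟩
  · have h1 : e.symm LinearMap.id = 1 := by
      rw [LinearEquiv.symm_apply_eq, he, one_smul]
    change unop (e.symm LinearMap.id) • y = y
    rw [h1, unop_one, one_smul]
  · let τ : Y →+ Tens R (C →ₗ[S] C) Y :=
      AddMonoidHom.mk' (fun y => Tens.tmul R LinearMap.id y) (Tens.tmul_add _)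
    refine DFunLike.congr_fun (Tens.hom_ext (f := τ.comp ε) (g := AddMonoidHom.id _)
      fun f y => ?_) t
    change Tens.tmul R LinearMap.id (unop (e.symm f) • y) = Tens.tmul R f y
    rw [← Tens.tmul_balanced, op_unop, ← he, e.apply_symm_apply]

theorem IsSemidualizing.isHomFinite (hC : IsSemidualizing R S C) (n : ℕ) :
    IsHomFinite n R S C C where
  resolution := hC.finite_left
  finPresented_hom := (finPresented_self n).of_equiv (homothetyEquiv hC.homothety_right)
  ext_vanish := hC.ext_left

/-- The unit factors as Y ≅ R ⊗ Y ≅ Hom_S(C, C) ⊗ Y followed by tensor evaluation for M = C. -/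
theorem bhomUnit_bijective {n : ℕ} (hC : IsSemidualizing R S C) (hY : IsFpFlat n R Y) :
    Function.Bijective (bhomUnit R S C Y) :=
  ((hC.isHomFinite n).homTens_bijective hC.finite_right.finPresented hY).comp
    (tmul_id_bijective hC.homothety_right)

end BHom

/-! ### The Bass class and its closure under kernels of surjections. -/

section Bass

variable {n : ℕ} {R S : Type u} [Ring R] [Ring S]
variable {C : Type u} [AddCommGroup C] [Module S C] [Module Rᵐᵒᵖ C] [SMulCommClass S Rᵐᵒᵖ C]
variable {K G N : Type u} [AddCommGroup K] [Module S K] [AddCommGroup G] [Module S G]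
  [AddCommGroup N] [Module S N]
variable {Y : Type u} [AddCommGroup Y] [Module R Y]

/-- The conditions of the Bass class with `Tor` vanishing expressed by dimension shifting. -/
structure IsBass (R S C N : Type u) [Ring R] [Ring S] [AddCommGroup C] [Module S C]
    [Module Rᵐᵒᵖ C] [SMulCommClass S Rᵐᵒᵖ C] [AddCommGroup N] [Module S N] : Prop where
  ext_vanish : ExtVanish S C N
  tor_vanish : ∀ j, TorSuccVanish R j C (BHom R S C N)
  eval_bijective : Function.Bijective (evalMap R S C N)

theorem InBassClass.isBass (h : InBassClass R S C N) : IsBass R S C N :=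
  ⟨h.ext_vanish, h.tor_vanish.torSuccVanish, h.eval_bijective⟩

theorem IsBass.of_equiv (e : G ≃ₗ[S] N) (h : IsBass R S C G) : IsBass R S C N where
  ext_vanish := h.ext_vanish.of_equiv e
  tor_vanish j := (h.tor_vanish j).of_equiv (BHom.congr R C e)
  eval_bijective := by
    have hc : evalMap R S C N ∘ Tens.congrR C S (BHom.congr R C e) = e ∘ evalMap R S C G :=
      funext (evalMap_mapR e.toLinearMap)
    refine ((Tens.congrR C S (BHom.congr R C e)).bijective.of_comp_iff _).1 ?_
    rw [hc]
    exact e.bijective.comp h.eval_bijective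

theorem isBass_tens (hR : IsNCoherent n Rᵐᵒᵖ) (hC : IsSemidualizing R S C)
    (hY : IsFpFlat n R Y) : IsBass R S C (Tens R C Y) where
  ext_vanish := (hC.isHomFinite n).extVanish_tens hC.finite_right.finPresented hY
  tor_vanish j := (hY.torSuccVanish hR (hC.finite_right.finPresented n) j).of_equiv
    (LinearEquiv.ofBijective _ (bhomUnit_bijective hC hY))
  eval_bijective := by
    let e := Tens.congrR C S (LinearEquiv.ofBijective _ (bhomUnit_bijective hC hY))
    refine (e.bijective.of_comp_iff _).1 ?_
    have : evalMap R S C (Tens R C Y) ∘ e = id := funext evalMap_bhomUnit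
    rw [this]
    exact Function.bijective_id

theorem IsCFpFlat.isBass (hR : IsNCoherent n Rᵐᵒᵖ) (hC : IsSemidualizing R S C)
    (h : IsCFpFlat n R S C N) : IsBass R S C N := by
  obtain ⟨Y, hY, ⟨e⟩⟩ := h
  exact (isBass_tens hR hC hY).of_equiv e.symm

theorem IsCFpFlat.isFpFlat_bhom (hC : IsSemidualizing R S C) (h : IsCFpFlat n R S C N) :
    IsFpFlat n R (BHom R S C N) := by
  obtain ⟨Y, hY, ⟨e⟩⟩ := h
  exact hY.of_equiv ((LinearEquiv.ofBijective _ (bhomUnit_bijective hC hY)).trans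
    (BHom.congr R C e.symm))

theorem IsBass.isCFpFlat_iff (hC : IsSemidualizing R S C) (h : IsBass R S C N) :
    IsCFpFlat n R S C N ↔ IsFpFlat n R (BHom R S C N) :=
  ⟨fun h' => h'.isFpFlat_bhom hC, fun h' =>
    ⟨ModuleCat.of R (BHom R S C N), h', ⟨(evalEquiv h.eval_bijective).symm⟩⟩⟩

theorem isCFpFlat_of_subsingleton [Subsingleton N] : IsCFpFlat n R S C N := by
  refine ⟨ModuleCat.of R PUnit.{u + 1}, isFpFlat_of_projective, ⟨?_⟩⟩
  have : Subsingleton (Tens R C PUnit.{u + 1}) := by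
    refine subsingleton_of_forall_eq 0 fun t => ?_
    induction t using Tens.induction_on with
    | zero => rfl
    | tmul x y => exact Tens.tmul_zero R x
    | add a b ha hb => rw [ha, hb, add_zero]
  exact 0

/-- Through the evaluation isomorphisms, C ⊗ Hom(C, g) becomes `g`, which is onto; hence C kills the
cokernel of Hom(C, g), and faithfulness forces it to vanish. Nothing about Ext of the kernel is
needed. -/
theorem IsBass.map_surjective (hC : IsFaithfullySemidualizing R S C) {g : G →ₗ[S] N}
    (hg : Function.Surjective g) (hG : IsBass R S C G) (hN : IsBass R S C N) :
    Function.Surjective (BHom.map R C g) := by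
  have : Subsingleton (Tens R C (BHom R S C N ⧸ LinearMap.range (BHom.map R C g))) := by
    refine subsingleton_of_forall_eq 0 fun t => ?_
    obtain ⟨t, rfl⟩ := Tens.mapR_surjective (Submodule.mkQ_surjective _) t
    obtain ⟨x, hx⟩ := hg (evalMap R S C N t)
    obtain ⟨s, rfl⟩ := hG.eval_bijective.2 x
    rw [← evalMap_mapR] at hx
    rw [← hN.eval_bijective.1 hx]
    exact (Tens.mapR_exact (LinearMap.exact_map_mkQ_range _)
      (Submodule.mkQ_surjective _)).apply_apply_eq_zero s
  have := subsingleton_of_subsingleton_tens (Q := BHom R S C N ⧸ LinearMap.range (BHom.map R C g))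
    hC.faithful_right
  exact LinearMap.range_eq_top.1 (Submodule.Quotient.subsingleton_iff.1 this)

theorem IsBass.kernel (hC : IsFaithfullySemidualizing R S C) {f : K →ₗ[S] G} {g : G →ₗ[S] N}
    (hf : Function.Injective f) (hfg : Function.Exact f g) (hg : Function.Surjective g)
    (hG : IsBass R S C G) (hN : IsBass R S C N) : IsBass R S C K := by
  have hs := hG.map_surjective hC hg hN
  have hi : Function.Injective (BHom.map R C f) := BHom.map_injective hf
  have he : Function.Exact (BHom.map R C f) (BHom.map R C g) := BHom.map_exact hf hfg
  -- Tor_1(C, Hom(C, N)) = 0 keeps the sequence of Hom modules exact after tensoring with `C`, so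
  -- evaluation for `K` can be compared with that for `G` and `N`.
  have hti : Function.Injective (Tens.mapR C (BHom.map R C f)) :=
    TorOneVanish.mapR_injective (hN.tor_vanish 0) hi he hs
  refine ⟨hG.ext_vanish.kernel hf hfg hg hN.ext_vanish hs, fun j =>
    (torSuccVanish_succ_iff_right hG.tor_vanish hi he hs j).1 (hN.tor_vanish (j + 1)), ?_, ?_⟩
  · refine (injective_iff_map_eq_zero _).2 fun t ht => ?_
    refine (injective_iff_map_eq_zero _).1 hti t ((injective_iff_map_eq_zero _).1
      hG.eval_bijective.1 _ ?_)
    rw [evalMap_mapR, ht, _root_.map_zero]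
  · intro k
    obtain ⟨s, hs'⟩ := hG.eval_bijective.2 (f k)
    have h0 : Tens.mapR C (BHom.map R C g) s = 0 := by
      refine (injective_iff_map_eq_zero _).1 hN.eval_bijective.1 _ ?_
      rw [evalMap_mapR, hs', hfg.apply_apply_eq_zero]
    obtain ⟨t, rfl⟩ := (Tens.mapR_exact he hs s).1 h0
    rw [evalMap_mapR] at hs'
    exact ⟨t, hf hs'⟩

end Bass

/-! ### Resolutions by C-fp_n-flat modules. -/

section Resolution

variable {n : ℕ} {R S : Type u} [Ring R] [Ring S]
variable {C : Type u} [AddCommGroup C] [Module S C] [Module Rᵐᵒᵖ C] [SMulCommClass S Rᵐᵒᵖ C]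
variable {N : Type u} [AddCommGroup N] [Module S N]

/-- Dropping the term in degree zero. -/
def LeftRes.tail {k : ℕ} (F : LeftRes S N (k + 1)) : LeftRes S (LinearMap.ker F.aug) k where
  X i := F.X (i + 1)
  d i := F.d (i + 1)
  aug := (F.d 0).codRestrict _ fun x => (F.exact_zero _).2 ⟨x, rfl⟩
  aug_surjective := by
    rintro ⟨y, hy⟩
    obtain ⟨x, hx⟩ := (F.exact_zero y).1 hy
    exact ⟨x, Subtype.ext hx⟩
  exact_zero y := by
    rw [← F.exact_succ 0 y]
    exact Subtype.ext_iff
  exact_succ i := F.exact_succ (i + 1)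
  bounded i hi := F.bounded (i + 1) (by omega)

/-- Splicing a surjection with a resolution of its kernel. -/
def LeftRes.cons {k : ℕ} {G : Type u} [AddCommGroup G] [Module S G] (g : G →ₗ[S] N)
    (hg : Function.Surjective g) (F : LeftRes S (LinearMap.ker g) k) : LeftRes S N (k + 1) where
  X i := match i with
    | 0 => ModuleCat.of S G
    | i + 1 => F.X i
  d i := match i with
    | 0 => (LinearMap.ker g).subtype ∘ₗ F.aug
    | i + 1 => F.d i
  aug := g
  aug_surjective := hg
  exact_zero y := by
    constructor
    · intro hy
      obtain ⟨x, hx⟩ := F.aug_surjective ⟨y, hy⟩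
      exact ⟨x, congrArg Subtype.val hx⟩
    · rintro ⟨x, rfl⟩
      exact (F.aug x).2
  exact_succ i := match i with
    | 0 => fun y => (Subtype.ext_iff (a1 := F.aug y) (a2 := 0)).symm.trans (F.exact_zero y)
    | i + 1 => F.exact_succ i
  bounded i hi := match i with
    | 0 => absurd hi (Nat.not_lt_zero _)
    | i + 1 => F.bounded i (by omega)

variable (N) in
/-- The resolution of `N` of length zero. -/
def LeftRes.self : LeftRes S N 0 where
  X i := match i with
    | 0 => ModuleCat.of S N
    | _ + 1 => ModuleCat.of S PUnit
  d _ := 0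
  aug := LinearMap.id
  aug_surjective := Function.surjective_id
  exact_zero y := by simp [eq_comm]
  exact_succ i y := ⟨fun _ => ⟨0, Subsingleton.elim (α := PUnit) _ _⟩, fun _ => rfl⟩
  bounded i hi := match i with
    | 0 => absurd hi (lt_irrefl 0)
    | _ + 1 => inferInstanceAs (Subsingleton PUnit)

/-- Enlarging the length bound. -/
def LeftRes.ofLE {j k : ℕ} (h : j ≤ k) (F : LeftRes S N j) : LeftRes S N k :=
  { F with bounded := fun i hi => F.bounded i (h.trans_lt hi) }

/-- The last term of a resolution by `C`-`fp_n`-flat modules. -/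
theorem LeftRes.isBass_and_isFpFlat_iff (hR : IsNCoherent n Rᵐᵒᵖ)
    (hC : IsFaithfullySemidualizing R S C) (hN : IsBass R S C N) {k : ℕ} (F : LeftRes S N k)
    (hF : ∀ i < k, IsCFpFlat n R S C (F.X i)) :
    IsBass R S C (F.X k) ∧ (IsFpFlat n R (BHom R S C (F.X k)) ↔
      ∀ (M : Type u) [AddCommGroup M] [Module Rᵐᵒᵖ M], FinPresented n Rᵐᵒᵖ M →
        TorSuccVanish R k M (BHom R S C N)) := by
  induction k generalizing N with
  | zero =>
    have hi : Function.Injective F.aug := by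
      refine (injective_iff_map_eq_zero _).2 fun x hx => ?_
      obtain ⟨y, rfl⟩ := (F.exact_zero x).1 hx
      have := F.bounded 1 one_pos
      rw [Subsingleton.elim y 0, _root_.map_zero]
    let e := LinearEquiv.ofBijective F.aug ⟨hi, F.aug_surjective⟩
    refine ⟨hN.of_equiv e.symm, (isFpFlat_iff hR).trans ⟨fun h M _ _ hM => ?_,
      fun h M _ _ hM => ?_⟩⟩
    · exact (h M hM).of_equiv (BHom.congr R C e)
    · exact TorOneVanish.of_equiv (BHom.congr R C e.symm) (h M hM)
  | succ k ih =>
    have h0 := hF 0 k.succ_pos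
    have hG := h0.isBass hR hC.toIsSemidualizing
    have hfg := LinearMap.exact_subtype_ker_map F.aug
    have hK := hG.kernel hC Subtype.val_injective hfg F.aug_surjective hN
    obtain ⟨h₁, h₂⟩ := ih hK F.tail fun i hi => hF (i + 1) (by omega)
    refine ⟨h₁, h₂.trans ?_⟩
    have hY := h0.isFpFlat_bhom hC.toIsSemidualizing
    -- For each fixed test module, shift dimension along Hom(C, -) of the first short exact
    -- sequence, whose middle term is fp_n-flat and hence acyclic.
    refine forall_congr' fun M => forall_congr' fun _ => forall_congr' fun _ =>
      forall_congr' fun hM => ?_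
    exact (torSuccVanish_succ_iff_right (hY.torSuccVanish hR hM)
      (BHom.map_injective Subtype.val_injective) (BHom.map_exact Subtype.val_injective hfg)
      (hG.map_surjective hC F.aug_surjective hN) k).symm

/-- Tensoring a projective cover of Hom(C, N) with `C` and evaluating maps a C-fp_n-flat module onto
`N`; the kernel is Bass, so the construction iterates. -/
theorem IsBass.exists_leftRes (hR : IsNCoherent n Rᵐᵒᵖ) (hC : IsFaithfullySemidualizing R S C)
    (hN : IsBass R S C N) (k : ℕ) :
    ∃ F : LeftRes S N k, ∀ i < k, IsCFpFlat n R S C (F.X i) := by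
  induction k generalizing N with
  | zero => exact ⟨LeftRes.self N, fun i hi => absurd hi (Nat.not_lt_zero i)⟩
  | succ k ih =>
    obtain ⟨Y, _, _, b, _, hb⟩ := exists_projective_cover R (BHom R S C N)
    have hY : IsFpFlat n R Y := isFpFlat_of_projective
    let e := evalEquiv hN.eval_bijective
    let g : Tens R C Y →ₗ[S] N := e.toLinearMap ∘ₗ
      { toFun := Tens.mapR C b
        map_add' := _root_.map_add _
        map_smul' := Tens.mapR_smul b }
    have hg : Function.Surjective g := e.surjective.comp (Tens.mapR_surjective hb)
    have hK := (isBass_tens hR hC.toIsSemidualizing hY).kernel hC Subtype.val_injective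
      (LinearMap.exact_subtype_ker_map g) hg hN
    obtain ⟨F, hF⟩ := ih hK
    refine ⟨F.cons g hg, ?_⟩
    rintro (_ | i) hi
    · exact ⟨ModuleCat.of R Y, hY, ⟨LinearEquiv.refl S _⟩⟩
    · exact hF i (by omega)

/-- A finite infimum is attained, and the zero terms beyond the attained length are themselves
C-fp_n-flat. -/
theorem cfpFlatDim_le_iff {k : ℕ} : cfpFlatDim n R S C N ≤ (k : ℕ∞) ↔
    ∃ F : LeftRes S N k, ∀ i ≤ k, IsCFpFlat n R S C (F.X i) := by
  constructor
  · intro h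
    have hne : {m : ℕ∞ | ∃ j : ℕ, m = j ∧
        ∃ F : LeftRes S N j, ∀ i ≤ j, IsCFpFlat n R S C (F.X i)}.Nonempty := by
      by_contra hne
      rw [cfpFlatDim, Set.not_nonempty_iff_eq_empty.1 hne, sInf_empty] at h
      exact absurd h (by simp)
    obtain ⟨j, hj, F, hF⟩ := csInf_mem hne
    have hjk : j ≤ k := by
      rw [cfpFlatDim, hj] at h
      exact_mod_cast h
    refine ⟨F.ofLE hjk, fun i _ => ?_⟩
    by_cases hij : i ≤ j
    · exact hF i hij
    · have := F.bounded i (not_le.1 hij)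
      exact isCFpFlat_of_subsingleton (N := F.X i)
  · intro h
    exact sInf_le ⟨k, rfl, h⟩

end Resolution

end Foxby

theorem theorem4p9 {R S : Type u} [Ring R] [Ring S]
    (C : Type u) [AddCommGroup C] [Module S C] [Module Rᵐᵒᵖ C] [SMulCommClass S Rᵐᵒᵖ C]
    (n k : ℕ) (hn : 1 ≤ n)
    (hR : Foxby.IsNCoherent n Rᵐᵒᵖ)
    (hC : Foxby.IsFaithfullySemidualizing R S C)
    (N : Type u) [AddCommGroup N] [Module S N]
    (hN : Foxby.InBassClass R S C N) :
    List.TFAE [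
      Foxby.cfpFlatDim n R S C N ≤ (k : ℕ∞),
      ∀ F : Foxby.LeftRes S N k,
        (∀ i < k, Foxby.IsCFpFlat n R S C (F.X i)) → Foxby.IsCFpFlat n R S C (F.X k),
      ∃ F : Foxby.LeftRes S N k, ∀ i ≤ k, Foxby.IsCFpFlat n R S C (F.X i)] := by
  tfae_have 1 ↔ 3 := Foxby.cfpFlatDim_le_iff
  tfae_have 3 → 2 := by
    rintro ⟨F, hF⟩ G hG
    obtain ⟨hFk, hFt⟩ := F.isBass_and_isFpFlat_iff hR hC hN.isBass fun i hi => hF i hi.le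
    obtain ⟨hGk, hGt⟩ := G.isBass_and_isFpFlat_iff hR hC hN.isBass hG
    -- Both last terms are governed by the same vanishing of Tor_{k+1} against Hom(C, N).
    rw [hGk.isCFpFlat_iff hC.toIsSemidualizing, hGt, ← hFt,
      ← hFk.isCFpFlat_iff hC.toIsSemidualizing]
    exact hF k le_rfl
  tfae_have 2 → 3 := by
    intro h
    obtain ⟨F, hF⟩ := hN.isBass.exists_leftRes hR hC k
    refine ⟨F, fun i hi => ?_⟩
    rcases hi.lt_or_eq with hi | rfl
    · exact hF i hi
    · exact h F hF
  tfae_finish
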